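/- Let $(\mathcal X,\mathcal F)$ be a measurable space and let $\mathcal P_0,\mathcal P_1$ be classes of probability measures on $\mathcal X$ that are jointly stochastically bounded by a pair $(\bar\nu_0,\underline\nu_1)\in\mathcal P_0\times\mathcal P_1$ with $\underline\nu_1\ne\bar\nu_0$. That is: $\underline\nu_1\ll\bar\nu_0$ and, with $L^*=\log\frac{d\underline\nu_1}{d\bar\nu_0}$ (any measurable version, with values in $[-\infty,\infty]$ and $\log 0=-\infty$), for all $\mu_0\in\mathcal P_0$, $\mu_1\in\mathcal P_1$ and $t\in\mathbb R$, $$\bar\nu_0(L^*\ge t)\ge \mu_0(L^*\ge t),\qquad \mu_1(L^*\ge t)\ge\underline\nu_1(L^*\ge t).$$ Let $X_1,X_2,\dots$ be observations in $\mathcal X$ and $\mathcal F_n=\sigma(X_1,\dots,X_n)$. Under $\mathsf P^{\nu}_m$, where $\nu=(\nu_0,\nu_1)$ and $m\ge 1$, they are independent with $X_n\sim\nu_0$ for $n<m$ and $X_n\sim\nu_1$ for $n\ge m$; under $\mathsf P^\nu_\infty$ they are i.i.d. with law $\nu_0$. Expectations under these laws are written $\mathsf E^\nu_m$, $\mathsf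 E^\nu_\infty$, and $\mathsf E^*_\infty$ denotes $\mathsf E^\nu_\infty$ when the pre-change law is $\bar\nu_0$. For a stopping time $\tau$ of $(\mathcal F_n)$ with values in $\{0,1,2,\dots\}\cup\{\infty\}$ put $$\mathrm{WDD}^\nu(\tau)=\sup_{m\ge1}\operatorname{ess\,sup}\ \mathsf E^\nu_m\big[(\tau-m+1)^+\,\big|\,\mathcal F_{m-1}\big],\qquad \mathrm{FAR}^\nu(\tau)=\frac1{\mathsf E^\nu_\infty[\tau]} .$$ For $\alpha\in(0,1)$ the robust CUSUM is $$\tau^*_C=\inf\Big\{n\ge1:\max_{1\le k\le n}\sum_{i=k}^nL^*(X_i)\ge\eta\Big\},$$ where the threshold $\eta\in\mathbb R$ is either $\eta=|\log\alpha|$ or any $\eta$ for which $\mathsf E^*_\infty[\tau^*_C]=1/\alpha$. Let $D(\cdot\|\cdot)$ be the Kullback–Leibler divergence. Let $\nu_0\in\mathcal P_0$ and $\nu_1\in\mathcal P_1$ with $D(\nu_1\|\bar\nu_0)<\infty$ and $D(\nu_1\|\underline\nu_1)<\infty$. Then: 1. $D(\nu_1\|\bar\nu_0)-D(\nu_1\|\underline\nu_1)>0$.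 2. $\mathrm{FAR}^\nu(\tau^*_C)\le\alpha$ for every $\alpha\in(0,1)$. 3. As $\alpha\to0$, $$\mathrm{WDD}^\nu(\tau^*_C)\le\frac{|\log\alpha|\,(1+o(1))}{D(\nu_1\|\bar\nu_0)-D(\nu_1\|\underline\nu_1)} .$$ 4. As $\alpha\to0$, $$\mathrm{WDD}^\nu(\tau^*_C)\le(1+o(1))\,\frac{D(\nu_1\|\nu_0)}{D(\nu_1\|\bar\nu_0)-D(\nu_1\|\underline\nu_1)}\;\mathrm{WDD}^\nu(\tau)$$ for every stopping time $\tau$ with $\mathrm{FAR}^\nu(\tau)\le\alpha$. In particular, when $\nu_1\ll\nu_0$, this holds for the optimal CUSUM $\tau=\tau_C$ between $\nu_1$ and $\nu_0$, which is defined like $\tau^*_C$ with $\log\frac{d\nu_1}{d\nu_0}$ in place of $L^*$ and a threshold $\eta'$ that is $|\log\alpha|$ or satisfies $\mathsf E^\nu_\infty[\tau_C]=1/\alpha$. The terms $o(1)$ may depend on $\mathcal P_0,\mathcal P_1,\bar\nu_0,\underline\nu_1,\nu_0,\nu_1$, but not on the choice of thresholds nor on $\tau$. -/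

import Mathlib

open MeasureTheory ProbabilityTheory InformationTheory Filter
open scoped ENNReal Topology

noncomputable section

namespace QuickestChange

variable {𝒳 : Type*} [MeasurableSpace 𝒳]

/-- The `n`-th observation, `n = 1, 2, …`, on the canonical space of sequences. The coordinates of
a sequence are numbered from `0`, so that `X_n` is the coordinate `n - 1`. -/
def obs (n : ℕ) (ω : ℕ → 𝒳) : 𝒳 := ω (n - 1)

/-- The sigma-algebra `F_n` generated by `X_1, …, X_n` (that is, by the coordinates
`0, …, n - 1`); `F_0` is trivial. -/
@[reducible] def obsSigma (𝒳 : Type*) [MeasurableSpace 𝒳] (n : ℕ) : MeasurableSpace (ℕ → 𝒳) :=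
  ⨆ i ∈ Finset.Icc 1 n, MeasurableSpace.comap (obs i) inferInstance

theorem measurable_obs (n : ℕ) : Measurable (obs (𝒳 := 𝒳) n) :=
  measurable_pi_apply (n - 1)

/-- The filtration `(F_n)` of the observations. -/
def obsFiltration (𝒳 : Type*) [MeasurableSpace 𝒳] :
    Filtration ℕ (MeasurableSpace.pi : MeasurableSpace (ℕ → 𝒳)) where
  seq := obsSigma 𝒳
  mono' := fun _ _ h => biSup_mono fun _ hi => Finset.Icc_subset_Icc_right h hi
  le' := fun _ => iSup₂_le fun i _ => (measurable_obs i).comap_le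

/-- The law `P_m` of the observations with change point `m ≥ 1`: the `X_n` are independent,
`X_n ∼ ν₀` for `n ≤ m - 1` and `X_n ∼ ν₁` for `n ≥ m`. -/
def changeLaw (ν₀ ν₁ : ProbabilityMeasure 𝒳) (m : ℕ) : Measure (ℕ → 𝒳) :=
  Measure.infinitePi fun i : ℕ => ((if i + 1 < m then ν₀ else ν₁ : ProbabilityMeasure 𝒳) : Measure 𝒳)

/-- The law `P_∞` of the observations when no change happens. -/
def noChangeLaw (ν₀ : ProbabilityMeasure 𝒳) : Measure (ℕ → 𝒳) :=
  Measure.infinitePi fun _ : ℕ => (ν₀ : Measure 𝒳)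

instance (ν₀ ν₁ : ProbabilityMeasure 𝒳) (m : ℕ) : IsProbabilityMeasure (changeLaw ν₀ ν₁ m) := by
  unfold changeLaw; infer_instance

instance (ν₀ : ProbabilityMeasure 𝒳) : IsProbabilityMeasure (noChangeLaw ν₀) := by
  unfold noChangeLaw; infer_instance

/-- A stopping rule: a stopping time of the observation filtration, possibly infinite. -/
def IsStoppingRule (τ : (ℕ → 𝒳) → ℕ∞) : Prop :=
  IsStoppingTime (obsFiltration 𝒳) τ

/-- The mean time to false alarm `E_∞[τ]`. -/
def meanTimeFA (ν₀ : ProbabilityMeasure 𝒳) (τ : (ℕ → 𝒳) → ℕ∞) : ℝ≥0∞ :=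
  ∫⁻ ω, (τ ω : ℝ≥0∞) ∂(noChangeLaw ν₀)

/-- The false alarm rate `FAR(τ) = 1 / E_∞[τ]`. -/
def FAR (ν₀ : ProbabilityMeasure 𝒳) (τ : (ℕ → 𝒳) → ℕ∞) : ℝ≥0∞ :=
  (meanTimeFA ν₀ τ)⁻¹

/-- The worst-case detection delay
`WDD(τ) = sup_{m ≥ 1} ess sup E_m[(τ - m + 1)^+ | F_{m-1}]`. Subtraction in `ℕ∞` is truncated at
zero, so `τ + 1 - m` is the positive part `(τ - m + 1)^+`. -/
def WDD (ν₀ ν₁ : ProbabilityMeasure 𝒳) (τ : (ℕ → 𝒳) → ℕ∞) : ℝ≥0∞ :=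
  ⨆ (m : ℕ) (_ : 1 ≤ m),
    essSup
      (condLExp (obsFiltration 𝒳 (m - 1)) (changeLaw ν₀ ν₁ m)
        fun ω => ((τ ω + 1 - (m : ℕ∞) : ℕ∞) : ℝ≥0∞))
      (changeLaw ν₀ ν₁ m)

/-- `L` is (a version of) the log-likelihood ratio between `ν₁` and `ν₀`, the logarithm of the
Radon-Nikodym derivative `dν₁/dν₀`, with `log 0 = -∞`. -/
structure IsLLR (L : 𝒳 → EReal) (ν₁ ν₀ : ProbabilityMeasure 𝒳) : Prop where
  absolutelyContinuous : (ν₁ : Measure 𝒳) ≪ (ν₀ : Measure 𝒳)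
  measurable : Measurable L
  ae_eq : L =ᵐ[(ν₀ : Measure 𝒳)]
    fun x => ENNReal.log ((ν₁ : Measure 𝒳).rnDeriv (ν₀ : Measure 𝒳) x)

/-- The CUSUM stopping rule with log-likelihood ratio `L` and threshold `η`:
`inf {n ≥ 1 : max_{1 ≤ k ≤ n} ∑_{i=k}^n L(X_i) ≥ η}`, with `inf ∅ = ∞`. -/
def cusum (L : 𝒳 → EReal) (η : ℝ) (ω : ℕ → 𝒳) : ℕ∞ :=
  ⨅ (n : ℕ) (_ : 1 ≤ n ∧
    (η : EReal) ≤ (Finset.Icc 1 n).sup fun k => ∑ i ∈ Finset.Icc k n, L (obs i ω)), (n : ℕ∞)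

/-- `μ` is stochastically larger than `μ'`: `μ [t, ∞] ≥ μ' [t, ∞]` for all real `t`. -/
def StochLarger (μ μ' : Measure EReal) : Prop :=
  ∀ t : ℝ, μ' (Set.Ici (t : EReal)) ≤ μ (Set.Ici (t : EReal))

/-- The pair of classes `(P₀, P₁)` is jointly stochastically bounded by `(ν₀bar, ν₁bar)`, where `L`
is the log-likelihood ratio between `ν₁bar` and `ν₀bar`. -/
structure JointlyStochBounded (P₀ P₁ : Set (ProbabilityMeasure 𝒳))
    (ν₀bar ν₁bar : ProbabilityMeasure 𝒳) (L : 𝒳 → EReal) : Prop where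
  mem₀ : ν₀bar ∈ P₀
  mem₁ : ν₁bar ∈ P₁
  isLLR : IsLLR L ν₁bar ν₀bar
  larger₀ : ∀ ν₀ ∈ P₀,
    StochLarger ((ν₀bar : Measure 𝒳).map L) ((ν₀ : Measure 𝒳).map L)
  larger₁ : ∀ ν₁ ∈ P₁,
    StochLarger ((ν₁ : Measure 𝒳).map L) ((ν₁bar : Measure 𝒳).map L)

/-- The thresholds used for the CUSUM rule at false alarm level `α`: either `η = |log α|`, or `η`
is such that `E_∞[τ] = 1 / α`. -/
def IsCusumThreshold (ν₀ : ProbabilityMeasure 𝒳) (L : 𝒳 → EReal) (α η : ℝ) : Prop :=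
  η = |Real.log α| ∨ meanTimeFA ν₀ (cusum L η) = (ENNReal.ofReal α)⁻¹

/-- The Kullback-Leibler divergence `D(μ ‖ ν)`. -/
def KL (μ ν : ProbabilityMeasure 𝒳) : ℝ≥0∞ :=
  klDiv (μ : Measure 𝒳) (ν : Measure 𝒳)

end QuickestChange

end

noncomputable section

namespace QuickestChange

variable {𝒳 : Type*} [MeasurableSpace 𝒳]

/-! Positivity. By the chain rule for densities, `L*` has mean J = D(ν₁‖ν₀bar) − D(ν₁‖ν₁bar) under
ν₁ (`IsLLR.integral_toReal`). Stochastic ordering gives E_{ν₁} exp(−L*) ≤ E_{ν₁bar} exp(−L*) ≤ 1, so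
0 ≤ E_{ν₁}[exp(−L*) − 1 + L*] ≤ J. If J were 0, then L* = 0 ν₁-a.s., which forces ν₁bar = ν₀bar
(`JointlyStochBounded.integral_toReal_pos`).

False alarms. Smaller increments make CUSUM stop later, so a quantile coupling shows that ν₀bar is
the worst pre-change law. Under ν₀bar the Shiryaev–Roberts statistic minus n is a martingale, and
the statistic is at least e^η at the alarm; hence E τ ≥ e^η (`exp_le_meanTimeFA_cusum`). The same
inequality bounds every calibrated threshold by |log α|.

Delay. Restarting CUSUM at the change point only postpones the alarm, and the restarted rule is
independent of the past, so the worst-case delay is at most the mean alarm time under i.i.d. ν₁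
(`WDD_cusum_le_meanTimeFA`). Wald's identity for increments truncated from above bounds this by (1 +
o(1))|log α|/J.

Comparison. For a rule with FAR ≤ α there is an n such that, before a change, the rule stops within
the next w steps with conditional probability at most 2wα given that it has not stopped by n
(`exists_window`). For w slightly below |log α|/D(ν₁‖ν₀), a change of measure shows that it also
rarely stops there when the change occurs at n + 1, so its delay is at least about w
(`eventually_le_WDD`). The quotient of the two bounds is the comparison. -/

/-! ### Past and future of the observations; densities of product laws -/

/-- The sigma-algebra generated by the coordinates `n, n + 1, …`. -/
@[reducible] def tailSigma (𝒳 : Type*) [MeasurableSpace 𝒳] (n : ℕ) : MeasurableSpace (ℕ → 𝒳) :=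
  ⨆ i ∈ Set.Ici n, MeasurableSpace.comap (fun ω => ω i) inferInstance

theorem obsSigma_eq (n : ℕ) :
    obsSigma 𝒳 n =
      ⨆ i ∈ Set.Iio n, MeasurableSpace.comap (fun ω : ℕ → 𝒳 => ω i) inferInstance := by
  apply le_antisymm
  · refine iSup₂_le fun i hi => ?_
    rw [Finset.mem_Icc] at hi
    exact le_iSup₂_of_le (i - 1) (Set.mem_Iio.2 (by omega)) le_rfl
  · refine iSup₂_le fun i hi => ?_
    rw [Set.mem_Iio] at hi
    exact le_iSup₂_of_le (i + 1) (Finset.mem_Icc.2 (by omega)) le_rfl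

theorem obsSigma_le (n : ℕ) : obsSigma 𝒳 n ≤ MeasurableSpace.pi := (obsFiltration 𝒳).le n

theorem tailSigma_le (n : ℕ) : tailSigma 𝒳 n ≤ MeasurableSpace.pi :=
  iSup₂_le fun i _ => (measurable_pi_apply i).comap_le

theorem measurable_obsSigma_eval {i n : ℕ} (h : i < n) :
    Measurable[obsSigma 𝒳 n] fun ω : ℕ → 𝒳 => ω i := by
  rw [obsSigma_eq, measurable_iff_comap_le]
  exact le_iSup₂_of_le i h le_rfl

theorem measurable_tailSigma_eval {i n : ℕ} (h : n ≤ i) :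
    Measurable[tailSigma 𝒳 n] fun ω : ℕ → 𝒳 => ω i := by
  rw [measurable_iff_comap_le]
  exact le_iSup₂_of_le i h le_rfl

theorem measurable_tailSigma_shift (n : ℕ) :
    Measurable[tailSigma 𝒳 n] fun (ω : ℕ → 𝒳) i => ω (i + n) :=
  @measurable_pi_lambda _ _ _ (tailSigma 𝒳 n) _ _
    fun i => measurable_tailSigma_eval (Nat.le_add_left n i)

theorem indep_obsSigma_tailSigma (μ : ℕ → Measure 𝒳) [∀ i, IsProbabilityMeasure (μ i)] (n : ℕ) :
    Indep (obsSigma 𝒳 n) (tailSigma 𝒳 n) (Measure.infinitePi μ) := by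
  rw [obsSigma_eq]
  refine indep_iSup_of_disjoint (fun i => (measurable_pi_apply i).comap_le) ?_ ?_
  · exact iIndepFun_infinitePi (X := fun _ (x : 𝒳) => x) (fun _ => measurable_id)
  · exact Set.disjoint_left.2 fun i h₁ h₂ => not_lt_of_ge (Set.mem_Ici.1 h₂) h₁

theorem obsSigma_le_comap_restrict (n : ℕ) :
    obsSigma 𝒳 n ≤ MeasurableSpace.comap (Finset.restrict (π := fun _ => 𝒳) (Finset.range n))
      MeasurableSpace.pi := by
  rw [obsSigma_eq]
  refine iSup₂_le fun i hi => ?_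
  have : (fun ω : ℕ → 𝒳 => ω i) = (fun x : (Finset.range n → 𝒳) =>
      x ⟨i, Finset.mem_range.2 hi⟩) ∘ Finset.restrict (Finset.range n) := rfl
  rw [this, ← MeasurableSpace.comap_comp]
  exact MeasurableSpace.comap_mono (measurable_pi_apply _).comap_le

/-- Events of F_n are cylinders over the first n coordinates, whose joint law is a finite product.
-/
theorem infinitePi_apply_congr {μ μ' : ℕ → Measure 𝒳} [∀ i, IsProbabilityMeasure (μ i)]
    [∀ i, IsProbabilityMeasure (μ' i)] {n : ℕ} (h : ∀ i < n, μ i = μ' i) {A : Set (ℕ → 𝒳)}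
    (hA : MeasurableSet[obsSigma 𝒳 n] A) :
    Measure.infinitePi μ A = Measure.infinitePi μ' A := by
  obtain ⟨B, hB, rfl⟩ := obsSigma_le_comap_restrict n _ hA
  rw [← Measure.map_apply (Finset.measurable_restrict _) hB,
    ← Measure.map_apply (Finset.measurable_restrict _) hB, Measure.infinitePi_map_restrict,
    Measure.infinitePi_map_restrict]
  congr 2
  funext i
  exact h i (Finset.mem_range.1 i.2)

/-- A product law is determined by its values on boxes, and there independence factors the integral.
This is the change of measure over a finite window. -/
theorem infinitePi_withDensity_prod (μ μ' : ℕ → Measure 𝒳) [∀ i, IsProbabilityMeasure (μ i)]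
    [∀ i, IsProbabilityMeasure (μ' i)] (f : 𝒳 → ℝ≥0∞) (hf : Measurable f) (S : Finset ℕ)
    (hS : ∀ i ∈ S, μ' i = (μ i).withDensity f) (hS' : ∀ i ∉ S, μ' i = μ i) :
    (Measure.infinitePi μ).withDensity (fun ω => ∏ i ∈ S, f (ω i)) = Measure.infinitePi μ' := by
  classical
  refine Measure.eq_infinitePi _ fun s t ht => ?_
  have hm : MeasurableSet (Set.pi (s : Set ℕ) t) := .pi s.countable_toSet fun i _ => ht i
  -- Side of the box and density in one factor per coordinate, so that independence is applied only
  -- once, over `s ∪ S`.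
  set g : ℕ → 𝒳 → ℝ≥0∞ := fun i x =>
    (if i ∈ s then (t i).indicator 1 x else 1) * (if i ∈ S then f x else 1) with hg
  have hgm : ∀ i, Measurable (g i) := fun i => by
    refine Measurable.mul ?_ ?_
    · split_ifs
      · exact measurable_one.indicator (ht i)
      · exact measurable_const
    · split_ifs
      · exact hf
      · exact measurable_const
  have hpt : ∀ ω : ℕ → 𝒳, (Set.pi (s : Set ℕ) t).indicator (fun ω => ∏ i ∈ S, f (ω i)) ω =
      ∏ i ∈ s ∪ S, g i (ω i) := fun ω => by
    simp only [hg, Finset.prod_mul_distrib]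
    rw [Finset.prod_ite_mem, Finset.prod_ite_mem, Finset.union_inter_cancel_left,
      Finset.union_inter_cancel_right]
    by_cases h : ω ∈ Set.pi (s : Set ℕ) t
    · have : ∏ i ∈ s, (t i).indicator (1 : 𝒳 → ℝ≥0∞) (ω i) = 1 :=
        Finset.prod_eq_one fun i hi => Set.indicator_of_mem (h i hi) _
      rw [Set.indicator_of_mem h, this, one_mul]
    · rw [Set.indicator_of_notMem h]
      simp only [Set.mem_pi, not_forall] at h
      obtain ⟨i, hi, hit⟩ := h
      rw [Finset.prod_eq_zero (i := i) hi (Set.indicator_of_notMem hit _), zero_mul]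
  rw [withDensity_apply _ hm, ← lintegral_indicator hm, lintegral_congr hpt]
  refine (lintegral_prod_eq_prod_lintegral_of_indepFun (s ∪ S) (fun i (ω : ℕ → 𝒳) => g i (ω i))
    (iIndepFun_infinitePi (X := g) hgm) (fun i => (hgm i).comp (measurable_pi_apply i))).trans ?_
  have hint : ∀ i, ∫⁻ ω, g i (ω i) ∂(Measure.infinitePi μ) = if i ∈ s then μ' i (t i) else 1 := by
    intro i
    rw [← lintegral_map (f := g i) (hgm i) (measurable_pi_apply i), Measure.infinitePi_map_eval]
    have h1 : ∫⁻ x, g i x ∂(μ i) =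
        ∫⁻ x, (if i ∈ s then (t i).indicator 1 x else 1) ∂(μ' i) := by
      by_cases hi : i ∈ S
      · rw [hS i hi, lintegral_withDensity_eq_lintegral_mul _ hf]
        · simp only [hg, hi, if_true, Pi.mul_apply, mul_comm]
        · split_ifs
          · exact measurable_one.indicator (ht i)
          · exact measurable_const
      · simp only [hg, hi, if_false, hS' i hi, mul_one]
    rw [h1]
    split_ifs
    · exact lintegral_indicator_one (ht i)
    · simp
  simp only [hint]
  rw [Finset.prod_ite_mem, Finset.union_inter_cancel_left]

/-! ### Expectations of extended stopping times as sums of tail probabilities -/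

theorem toENNReal_eq_tsum (a : ℕ∞) :
    (a : ℝ≥0∞) = ∑' i : ℕ, if (i : ℕ∞) < a then 1 else 0 := by
  induction a with
  | top => simp
  | coe n =>
    rw [tsum_eq_sum (s := Finset.range n)]
    · simp only [Nat.cast_lt]
      rw [Finset.sum_ite_of_true (fun i hi => Finset.mem_range.1 hi)]
      simp
    · intro i hi
      simpa using hi

theorem lintegral_toENNReal {Ω : Type*} [MeasurableSpace Ω] (P : Measure Ω) {τ : Ω → ℕ∞}
    (hτ : ∀ i : ℕ, MeasurableSet {ω | (i : ℕ∞) < τ ω}) :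
    ∫⁻ ω, (τ ω : ℝ≥0∞) ∂P = ∑' i : ℕ, P {ω | (i : ℕ∞) < τ ω} := by
  have h : ∀ i : ℕ, (fun ω => if (i : ℕ∞) < τ ω then (1 : ℝ≥0∞) else 0) =
      {ω | (i : ℕ∞) < τ ω}.indicator 1 := fun i => by
    ext ω
    simp [Set.indicator_apply]
  simp only [toENNReal_eq_tsum]
  rw [lintegral_tsum]
  · exact tsum_congr fun i => by rw [h, lintegral_indicator_one (hτ i)]
  · exact fun i => by
      rw [h]
      exact (measurable_one.indicator (hτ i)).aemeasurable

theorem measurable_toENNReal {Ω : Type*} {_ : MeasurableSpace Ω} {τ : Ω → ℕ∞}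
    (hτ : ∀ i : ℕ, MeasurableSet {ω | (i : ℕ∞) < τ ω}) : Measurable fun ω => (τ ω : ℝ≥0∞) := by
  simp only [toENNReal_eq_tsum]
  exact Measurable.tsum fun i => Measurable.ite (hτ i) measurable_const measurable_const

theorem IsStoppingRule.measurableSet_lt {τ : (ℕ → 𝒳) → ℕ∞} (hτ : IsStoppingRule τ) (n : ℕ) :
    MeasurableSet[obsSigma 𝒳 n] {ω | (n : ℕ∞) < τ ω} :=
  hτ.measurableSet_gt n

theorem IsStoppingRule.measurableSet_lt' {τ : (ℕ → 𝒳) → ℕ∞} (hτ : IsStoppingRule τ) (n : ℕ) :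
    MeasurableSet {ω | (n : ℕ∞) < τ ω} :=
  obsSigma_le n _ (hτ.measurableSet_lt n)

/-! ### Pathwise properties of the CUSUM rule -/

theorem cusum_le_iff {α : Type*} {L : α → EReal} {η : ℝ} {ω : ℕ → α} {n : ℕ} :
    cusum L η ω ≤ n ↔ ∃ j ∈ Finset.Icc 1 n, ∃ k ∈ Finset.Icc 1 j,
      (η : EReal) ≤ ∑ i ∈ Finset.Icc k j, L (obs i ω) := by
  constructor
  · intro h
    by_contra hcon
    push Not at hcon
    have : ((n + 1 : ℕ) : ℕ∞) ≤ cusum L η ω := by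
      refine le_iInf₂ fun j hj => ?_
      rw [Nat.cast_le]
      by_contra hjn
      obtain ⟨k, hk, hk'⟩ := (Finset.le_sup_iff (EReal.bot_lt_coe η)).1 hj.2
      exact (hcon j (Finset.mem_Icc.2 ⟨hj.1, by omega⟩) k hk).not_ge hk'
    have h' := this.trans h
    rw [Nat.cast_le] at h'
    omega
  · rintro ⟨j, hj, k, hk, h⟩
    rw [Finset.mem_Icc] at hj
    exact (iInf₂_le j ⟨hj.1, (Finset.le_sup_iff (EReal.bot_lt_coe η)).2 ⟨k, hk, h⟩⟩).trans
      (Nat.cast_le.2 hj.2)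

theorem exp_sum (s : Finset ℕ) (f : ℕ → EReal) :
    EReal.exp (∑ i ∈ s, f i) = ∏ i ∈ s, EReal.exp (f i) := by
  classical
  induction s using Finset.induction_on with
  | empty => simp
  | insert a s ha ih => rw [Finset.sum_insert ha, Finset.prod_insert ha, EReal.exp_add, ih]

theorem isStoppingRule_cusum {L : 𝒳 → EReal} (hL : Measurable L) (η : ℝ) :
    IsStoppingRule (cusum L η) := by
  intro n
  have : {ω : ℕ → 𝒳 | cusum L η ω ≤ n} = ⋃ j ∈ Finset.Icc 1 n, ⋃ k ∈ Finset.Icc 1 j,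
      {ω | EReal.exp η ≤ ∏ i ∈ Finset.Icc k j, EReal.exp (L (obs i ω))} := by
    ext ω
    simp only [Set.mem_ofPred_eq, cusum_le_iff, Set.mem_iUnion, ← exp_sum, EReal.exp_le_exp_iff,
      exists_prop]
  change MeasurableSet[obsSigma 𝒳 n] {ω : ℕ → 𝒳 | cusum L η ω ≤ n}
  rw [this]
  refine Finset.measurableSet_biUnion _ fun j hj => Finset.measurableSet_biUnion _ fun k _ => ?_
  refine measurableSet_le measurable_const (Finset.measurable_prod _ fun i hi => ?_)
  rw [Finset.mem_Icc] at hj hi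
  exact (EReal.measurable_exp.comp hL).comp (measurable_obsSigma_eval (by omega))

theorem cusum_mono {α : Type*} (L : α → EReal) {η η' : ℝ} (h : η ≤ η') (ω : ℕ → α) :
    cusum L η ω ≤ cusum L η' ω :=
  le_iInf₂ fun n hn => iInf₂_le n ⟨hn.1, (EReal.coe_le_coe_iff.2 h).trans hn.2⟩

theorem cusum_id_antitone (η : ℝ) : Antitone (cusum (id : EReal → EReal) η) := fun _ _ h =>
  le_iInf₂ fun n hn => iInf₂_le n ⟨hn.1, hn.2.trans <| Finset.sup_mono_fun fun _ _ =>
    Finset.sum_le_sum fun i _ => h (i - 1)⟩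

/-- The rule restarted at m maximises over fewer starting points: an alarm on [k, n] of the shifted
sequence is an alarm on [k + m − 1, n + m − 1] of the original one. -/
theorem cusum_add_one_sub_le {α : Type*} (L : α → EReal) (η : ℝ) {m : ℕ} (hm : 1 ≤ m)
    (ω : ℕ → α) :
    cusum L η ω + 1 - m ≤ cusum L η fun i => ω (i + (m - 1)) := by
  refine le_iInf₂ fun n hn => ?_
  obtain ⟨k, hk, hk'⟩ := (Finset.le_sup_iff (EReal.bot_lt_coe η)).1 hn.2
  rw [Finset.mem_Icc] at hk
  have h : cusum L η ω ≤ ((n + (m - 1) : ℕ) : ℕ∞) := by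
    refine cusum_le_iff.2 ⟨n + (m - 1), Finset.mem_Icc.2 ⟨by omega, le_rfl⟩, k + (m - 1),
      Finset.mem_Icc.2 ⟨by omega, by omega⟩, hk'.trans_eq ?_⟩
    rw [← Finset.map_add_right_Icc, Finset.sum_map]
    refine Finset.sum_congr rfl fun i hi => ?_
    rw [Finset.mem_Icc] at hi
    simp only [obs, addRightEmbedding_apply]
    congr 2
    omega
  rw [tsub_le_iff_right]
  refine (add_le_add_left h 1).trans_eq ?_
  norm_cast
  omega

/-! ### Stochastic order and quantile coupling -/

/-- The upper quantile function of a probability measure on the extended reals. -/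
def upperQuantile (μ : Measure EReal) (u : ℝ) : EReal :=
  sSup {t | ENNReal.ofReal u ≤ μ (Set.Ici t)}

/-- The supremum is attained, by continuity of the measure along increasing thresholds. The bound `u
≤ 1` handles a supremum equal to `⊥`. -/
theorem le_upperQuantile_iff {μ : Measure EReal} [IsProbabilityMeasure μ] {u : ℝ} (hu : u ≤ 1)
    (t : EReal) : t ≤ upperQuantile μ u ↔ ENNReal.ofReal u ≤ μ (Set.Ici t) := by
  refine ⟨fun h => ?_, fun h => le_sSup h⟩
  refine le_trans ?_ (measure_mono (Set.Ici_subset_Ici.2 h))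
  rcases eq_bot_or_bot_lt (upperQuantile μ u) with h0 | h0
  · simpa [h0] using hu
  obtain ⟨x, hmono, hx, hlim⟩ := exists_seq_strictMono_tendsto' h0
  have hI : Set.Ici (upperQuantile μ u) = ⋂ n, Set.Ici (x n) := by
    ext y
    simp only [Set.mem_Ici, Set.mem_iInter]
    exact ⟨fun hy n => (hx n).2.le.trans hy, fun hy => le_of_tendsto' hlim hy⟩
  rw [hI]
  refine ge_of_tendsto' (tendsto_measure_iInter_atTop (μ := μ)
    (fun n => measurableSet_Ici.nullMeasurableSet)
    (fun i j hij => Set.Ici_subset_Ici.2 (hmono.monotone hij)) ⟨0, measure_ne_top _ _⟩)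
    fun n => ?_
  obtain ⟨a, ha, hlt⟩ := lt_sSup_iff.1 (hx n).2
  exact le_trans ha (measure_mono (Set.Ici_subset_Ici.2 hlt.le))

theorem upperQuantile_antitone (μ : Measure EReal) : Antitone (upperQuantile μ) := fun _ _ h =>
  sSup_le_sSup fun _ ht => (ENNReal.ofReal_le_ofReal h).trans ht

instance : IsProbabilityMeasure (volume.restrict (Set.Ioc (0 : ℝ) 1)) := ⟨by simp⟩

theorem map_upperQuantile (μ : Measure EReal) [IsProbabilityMeasure μ] :
    (volume.restrict (Set.Ioc (0 : ℝ) 1)).map (upperQuantile μ) = μ := by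
  refine (Measure.ext_of_Ici μ _ fun a => ?_).symm
  rw [Measure.map_apply (upperQuantile_antitone μ).measurable measurableSet_Ici,
    Measure.restrict_apply ((upperQuantile_antitone μ).measurable measurableSet_Ici)]
  have : upperQuantile μ ⁻¹' Set.Ici a ∩ Set.Ioc 0 1 = Set.Ioc 0 (μ (Set.Ici a)).toReal := by
    ext u
    simp only [Set.mem_inter_iff, Set.mem_preimage, Set.mem_Ioc]
    constructor
    · rintro ⟨h, h0, h1⟩
      exact ⟨h0, (ENNReal.ofReal_le_iff_le_toReal (measure_ne_top _ _)).1
        ((le_upperQuantile_iff h1 a).1 h)⟩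
    · rintro ⟨h0, h⟩
      have h1 : u ≤ 1 := h.trans measureReal_le_one
      exact ⟨(le_upperQuantile_iff h1 a).2
        ((ENNReal.ofReal_le_iff_le_toReal (measure_ne_top _ _)).2 h), h0, h1⟩
  rw [this, Real.volume_Ioc, sub_zero, ENNReal.ofReal_toReal (measure_ne_top _ _)]

/-- Only real t are covered by the definition: `⊥` uses equal total mass, and `⊤` is a limit of
integers. -/
theorem StochLarger.measure_Ici_le {μ μ' : Measure EReal} [IsProbabilityMeasure μ]
    [IsProbabilityMeasure μ'] (h : StochLarger μ μ') (t : EReal) :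
    μ' (Set.Ici t) ≤ μ (Set.Ici t) := by
  induction t with
  | bot => simp
  | coe t => exact h t
  | top =>
    have hI : Set.Ici (⊤ : EReal) = ⋂ n : ℕ, Set.Ici (((n : ℝ)) : EReal) := by
      ext y
      simp only [Set.mem_Ici, Set.mem_iInter, top_le_iff]
      refine ⟨fun hy n => hy ▸ le_top, fun hy => ?_⟩
      rw [EReal.eq_top_iff_forall_lt]
      intro x
      obtain ⟨n, hn⟩ := exists_nat_gt x
      exact (EReal.coe_lt_coe_iff.2 hn).trans_le (hy n)
    have hanti : Antitone fun n : ℕ => Set.Ici (((n : ℝ)) : EReal) := fun i j hij =>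
      Set.Ici_subset_Ici.2 (EReal.coe_le_coe_iff.2 (Nat.cast_le.2 hij))
    rw [hI]
    exact le_of_tendsto_of_tendsto'
      (tendsto_measure_iInter_atTop (fun n => measurableSet_Ici.nullMeasurableSet) hanti
        ⟨0, measure_ne_top _ _⟩)
      (tendsto_measure_iInter_atTop (fun n => measurableSet_Ici.nullMeasurableSet) hanti
        ⟨0, measure_ne_top _ _⟩)
      fun n => h n

theorem StochLarger.measure_Ioi_le {μ μ' : Measure EReal} (h : StochLarger μ μ') (t : ℝ) :
    μ' (Set.Ioi (t : EReal)) ≤ μ (Set.Ioi (t : EReal)) := by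
  have hI : Set.Ioi (t : EReal) = ⋃ n : ℕ, Set.Ici ((t + 1 / ((n : ℝ) + 1) : ℝ) : EReal) := by
    ext y
    simp only [Set.mem_Ioi, Set.mem_iUnion, Set.mem_Ici]
    constructor
    · intro hy
      obtain ⟨z, htz, hzy⟩ := EReal.exists_between_coe_real hy
      obtain ⟨n, hn⟩ := exists_nat_one_div_lt (sub_pos.2 (EReal.coe_lt_coe_iff.1 htz))
      exact ⟨n, le_trans (EReal.coe_le_coe_iff.2 (by linarith)) hzy.le⟩
    · rintro ⟨n, hn⟩
      refine lt_of_lt_of_le (EReal.coe_lt_coe_iff.2 ?_) hn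
      have : (0 : ℝ) < 1 / ((n : ℝ) + 1) := Nat.one_div_pos_of_nat
      linarith
  have hmono : Monotone fun n : ℕ => Set.Ici ((t + 1 / ((n : ℝ) + 1) : ℝ) : EReal) := by
    intro i j hij
    refine Set.Ici_subset_Ici.2 (EReal.coe_le_coe_iff.2 ?_)
    have := Nat.one_div_le_one_div (α := ℝ) hij
    linarith
  rw [hI, hmono.measure_iUnion, hmono.measure_iUnion]
  exact iSup_mono fun n => h _

theorem StochLarger.upperQuantile_le {μ μ' : Measure EReal} [IsProbabilityMeasure μ]
    [IsProbabilityMeasure μ'] (h : StochLarger μ μ') (u : ℝ) :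
    upperQuantile μ' u ≤ upperQuantile μ u :=
  sSup_le_sSup fun t ht => le_trans ht (h.measure_Ici_le t)

theorem StochLarger.lintegral_antitone_le {μ μ' : Measure EReal} [IsProbabilityMeasure μ]
    [IsProbabilityMeasure μ'] (h : StochLarger μ μ') {f : EReal → ℝ≥0∞} (hf : Antitone f) :
    ∫⁻ x, f x ∂μ ≤ ∫⁻ x, f x ∂μ' := by
  have key : ∀ (ρ : Measure EReal) [IsProbabilityMeasure ρ],
      ∫⁻ x, f x ∂ρ = ∫⁻ u in Set.Ioc (0 : ℝ) 1, f (upperQuantile ρ u) := fun ρ _ => by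
    rw [← lintegral_map hf.measurable (upperQuantile_antitone ρ).measurable, map_upperQuantile]
  rw [key, key]
  exact lintegral_mono fun u => hf (h.upperQuantile_le u)

/-- Coupling: both sequences are quantile transforms of one i.i.d. uniform sequence and are then
ordered coordinatewise. -/
theorem StochLarger.lintegral_infinitePi_le {μ μ' : Measure EReal} [IsProbabilityMeasure μ]
    [IsProbabilityMeasure μ'] (h : StochLarger μ μ') {f : (ℕ → EReal) → ℝ≥0∞}
    (hf : Antitone f) (hfm : Measurable f) :
    ∫⁻ x, f x ∂(Measure.infinitePi fun _ => μ) ≤ ∫⁻ x, f x ∂(Measure.infinitePi fun _ => μ') := by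
  have key : ∀ (ρ : Measure EReal) [IsProbabilityMeasure ρ],
      ∫⁻ x, f x ∂(Measure.infinitePi fun _ => ρ) = ∫⁻ u, f (fun i => upperQuantile ρ (u i))
        ∂(Measure.infinitePi fun _ : ℕ => volume.restrict (Set.Ioc (0 : ℝ) 1)) := by
    intro ρ _
    have hm : ∀ _ : ℕ, Measurable (upperQuantile ρ) := fun _ =>
      (upperQuantile_antitone ρ).measurable
    have := Measure.infinitePi_map_pi
      (fun _ : ℕ => volume.restrict (Set.Ioc (0 : ℝ) 1)) hm
    simp only [map_upperQuantile] at this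
    rw [← this, lintegral_map hfm]
    exact measurable_pi_lambda _ fun i => (hm i).comp (measurable_pi_apply i)
  rw [key, key]
  exact lintegral_mono fun u => hf fun i => h.upperQuantile_le (u i)

theorem meanTimeFA_cusum_eq {L : 𝒳 → EReal} (hL : Measurable L) (ν : ProbabilityMeasure 𝒳)
    (η : ℝ) :
    meanTimeFA ν (cusum L η) = ∫⁻ x, (cusum (id : EReal → EReal) η x : ℝ≥0∞)
      ∂(Measure.infinitePi fun _ => (ν : Measure 𝒳).map L) := by
  rw [← Measure.infinitePi_map_pi (fun _ : ℕ => (ν : Measure 𝒳)) (fun _ => hL), lintegral_map]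
  · rfl
  · exact measurable_toENNReal (isStoppingRule_cusum measurable_id η).measurableSet_lt'
  · exact measurable_pi_lambda _ fun i => hL.comp (measurable_pi_apply i)

theorem meanTimeFA_cusum_le_of_stochLarger {L : 𝒳 → EReal} (hL : Measurable L)
    {ν ν' : ProbabilityMeasure 𝒳}
    (h : StochLarger ((ν : Measure 𝒳).map L) ((ν' : Measure 𝒳).map L)) (η : ℝ) :
    meanTimeFA ν (cusum L η) ≤ meanTimeFA ν' (cusum L η) := by
  have h1 := Measure.isProbabilityMeasure_map (μ := (ν : Measure 𝒳)) hL.aemeasurable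
  have h2 := Measure.isProbabilityMeasure_map (μ := (ν' : Measure 𝒳)) hL.aemeasurable
  rw [meanTimeFA_cusum_eq hL, meanTimeFA_cusum_eq hL]
  refine h.lintegral_infinitePi_le (fun x y hxy => ?_)
    (measurable_toENNReal (isStoppingRule_cusum measurable_id η).measurableSet_lt')
  exact ENat.toENNReal_le.2 (cusum_id_antitone η hxy)

/-! ### Mean time to false alarm from below -/

/-- The Shiryaev–Roberts statistic of the observations with likelihood ratio `f`. -/
def shiryaevRoberts {α : Type*} (f : α → ℝ≥0∞) : ℕ → (ℕ → α) → ℝ≥0∞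
  | 0, _ => 0
  | n + 1, ω => (1 + shiryaevRoberts f n ω) * f (ω n)

theorem measurable_shiryaevRoberts {f : 𝒳 → ℝ≥0∞} (hf : Measurable f) (n : ℕ) :
    Measurable[obsSigma 𝒳 n] (shiryaevRoberts f n) := by
  induction n with
  | zero => exact measurable_const
  | succ n ih =>
    exact ((ih.mono ((obsFiltration 𝒳).mono n.le_succ) le_rfl).const_add 1).mul
      (hf.comp (measurable_obsSigma_eval n.lt_succ_self))

theorem prod_le_shiryaevRoberts {α : Type*} (f : α → ℝ≥0∞) (ω : ℕ → α) {k n : ℕ}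
    (hk : k ∈ Finset.Icc 1 n) :
    ∏ i ∈ Finset.Icc k n, f (obs i ω) ≤ shiryaevRoberts f n ω := by
  induction n generalizing k with
  | zero => simp at hk
  | succ n ih =>
    rw [Finset.mem_Icc] at hk
    rw [Finset.prod_Icc_succ_top hk.2, shiryaevRoberts]
    refine mul_le_mul' ?_ le_rfl
    rcases hk.2.lt_or_eq with h | rfl
    · exact (ih (Finset.mem_Icc.2 ⟨hk.1, by omega⟩)).trans le_add_self
    · simp

/-- The martingale property of the statistic minus n: the new factor is independent of F_n and has
mean one. -/
theorem setLIntegral_shiryaevRoberts_succ (ν : ProbabilityMeasure 𝒳) {f : 𝒳 → ℝ≥0∞}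
    (hf : Measurable f) (h1 : ∫⁻ x, f x ∂(ν : Measure 𝒳) = 1) {n : ℕ} {B : Set (ℕ → 𝒳)}
    (hB : MeasurableSet[obsSigma 𝒳 n] B) :
    ∫⁻ ω in B, shiryaevRoberts f (n + 1) ω ∂(noChangeLaw ν) =
      noChangeLaw ν B + ∫⁻ ω in B, shiryaevRoberts f n ω ∂(noChangeLaw ν) := by
  have hB' := obsSigma_le n _ hB
  have hR := measurable_shiryaevRoberts hf n
  have hft : Measurable[tailSigma 𝒳 n] fun ω : ℕ → 𝒳 => f (ω n) :=
    hf.comp (measurable_tailSigma_eval le_rfl)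
  have hpt : ∀ ω, B.indicator (shiryaevRoberts f (n + 1)) ω =
      B.indicator (fun ω => 1 + shiryaevRoberts f n ω) ω * f (ω n) := fun ω => by
    by_cases h : ω ∈ B <;> simp [h, shiryaevRoberts]
  have hf1 : ∫⁻ ω, f (ω n) ∂(noChangeLaw ν) = 1 := by
    rw [← lintegral_map (f := f) hf (measurable_pi_apply n), noChangeLaw,
      Measure.infinitePi_map_eval, h1]
  rw [← lintegral_indicator hB', lintegral_congr hpt, noChangeLaw,
    lintegral_mul_eq_lintegral_mul_lintegral_of_independent_measurableSpace
      (g := fun ω => f (ω n)) (obsSigma_le n)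
      (tailSigma_le n) (indep_obsSigma_tailSigma _ n) ((hR.const_add 1).indicator hB)
      hft, ← noChangeLaw, hf1, mul_one,
    lintegral_indicator hB', lintegral_add_left measurable_const]
  simp

/-- Optional stopping at min(τ, n), by induction; on the stopped part the statistic is replaced by
its lower bound c. The right side is E[min(τ, n)]. -/
theorem exp_mul_measure_le_sum {τ : (ℕ → 𝒳) → ℕ∞} (hτ : IsStoppingRule τ)
    (ν : ProbabilityMeasure 𝒳) {f : 𝒳 → ℝ≥0∞}
    (hf : Measurable f) (h1 : ∫⁻ x, f x ∂(ν : Measure 𝒳) = 1) {c : ℝ≥0∞}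
    (hc : ∀ n : ℕ, ∀ ω, τ ω = n → c ≤ shiryaevRoberts f n ω) (n : ℕ)
    (h0 : ∀ ω, 0 < τ ω) :
    ∫⁻ ω in {ω | (n : ℕ∞) < τ ω}, shiryaevRoberts f n ω ∂(noChangeLaw ν) +
        c * noChangeLaw ν {ω | τ ω ≤ n} ≤
      ∑ i ∈ Finset.range n, noChangeLaw ν {ω | (i : ℕ∞) < τ ω} := by
  induction n with
  | zero =>
    have : {ω | τ ω ≤ (0 : ℕ)} = ∅ := by
      ext ω
      simpa using (h0 ω).ne'
    rw [this]
    simp [shiryaevRoberts]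
  | succ n ih =>
    rw [Finset.sum_range_succ, add_comm (∑ i ∈ Finset.range n, _)]
    refine le_trans ?_ (add_le_add_right ih _)
    rw [← add_assoc, ← setLIntegral_shiryaevRoberts_succ ν hf h1 (hτ.measurableSet_lt n)]
    have hm : MeasurableSet {ω | τ ω = (n + 1 : ℕ)} :=
      obsSigma_le _ _ (hτ.measurableSet_eq (n + 1))
    -- The paths that stop at n + 1 pay for the growth of the term with factor c.
    have hA : {ω | (n : ℕ∞) < τ ω} = {ω | ((n + 1 : ℕ) : ℕ∞) < τ ω} ∪ {ω | τ ω = (n + 1 : ℕ)} := by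
      ext ω
      simp only [Set.mem_ofPred_eq, Set.mem_union]
      rw [← ENat.add_one_le_iff (ENat.natCast_ne_top n), le_iff_lt_or_eq, eq_comm (b := τ ω)]
      simp
    have hC : {ω | τ ω ≤ (n + 1 : ℕ)} = {ω | τ ω = (n + 1 : ℕ)} ∪ {ω | τ ω ≤ n} := by
      ext ω
      simp only [Set.mem_ofPred_eq, Set.mem_union]
      rw [le_iff_eq_or_lt, ← ENat.lt_add_one_iff (ENat.natCast_ne_top n)]
      simp
    rw [hA, lintegral_union hm, hC, add_assoc]
    · refine add_le_add_right ?_ _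
      refine (mul_le_mul' le_rfl (measure_union_le _ _)).trans ?_
      rw [mul_add]
      refine add_le_add_left ?_ _
      rw [← setLIntegral_const]
      exact setLIntegral_mono' hm fun ω hω => hc _ ω hω
    · rw [Set.disjoint_left]
      intro ω h h'
      simp only [Set.mem_ofPred_eq] at h h'
      exact h.ne' h'

theorem exp_le_meanTimeFA_cusum {L : 𝒳 → EReal} (hL : Measurable L) (ν : ProbabilityMeasure 𝒳)
    (h1 : ∫⁻ x, EReal.exp (L x) ∂(ν : Measure 𝒳) = 1) (η : ℝ) :
    EReal.exp η ≤ meanTimeFA ν (cusum L η) := by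
  have hτ := isStoppingRule_cusum hL η
  have h0 : ∀ ω, 0 < cusum L η ω := fun ω => by
    rw [pos_iff_ne_zero]
    intro h
    have := cusum_le_iff.1 (show cusum L η ω ≤ (0 : ℕ) from h.le)
    simp at this
  have hc : ∀ n : ℕ, ∀ ω, cusum L η ω = n →
      EReal.exp η ≤ shiryaevRoberts (fun x => EReal.exp (L x)) n ω := by
    intro n ω h
    obtain ⟨j, hj, k, hk, hle⟩ := cusum_le_iff.1 h.le
    -- A crossing at an earlier j would have stopped the rule before n.
    have hjn : j = n := by
      have : cusum L η ω ≤ j := cusum_le_iff.2 ⟨j, by simp at hj ⊢; omega, k, hk, hle⟩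
      rw [h, Nat.cast_le] at this
      simp at hj
      omega
    subst hjn
    refine le_trans ?_ (prod_le_shiryaevRoberts _ ω hk)
    rwa [← exp_sum, EReal.exp_le_exp_iff]
  have hsum : meanTimeFA ν (cusum L η) = ∑' i : ℕ, noChangeLaw ν {ω | (i : ℕ∞) < cusum L η ω} :=
    lintegral_toENNReal _ hτ.measurableSet_lt'
  have hle : ∀ n : ℕ, EReal.exp η * noChangeLaw ν {ω | cusum L η ω ≤ n} ≤
      meanTimeFA ν (cusum L η) := fun n => by
    rw [hsum]
    exact le_add_self.trans ((exp_mul_measure_le_sum hτ ν (EReal.measurable_exp.comp hL) h1 hc n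
      h0).trans (ENNReal.sum_le_tsum _))
  -- If the alarm is a.s. finite, let n → ∞ in `hle`; otherwise the mean is infinite.
  rcases eq_or_ne (noChangeLaw ν {ω | cusum L η ω = ⊤}) 0 with h | h
  · have hmono : Monotone fun n : ℕ => {ω | cusum L η ω ≤ n} := by
      intro i j hij ω hω
      simp only [Set.mem_ofPred_eq] at hω ⊢
      exact hω.trans (Nat.cast_le.2 hij)
    have hU : noChangeLaw ν (⋃ n : ℕ, {ω | cusum L η ω ≤ n}) = 1 := by
      rw [← measure_univ (μ := noChangeLaw ν)]
      refine measure_congr (eventuallyEq_univ.2 ?_)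
      rw [mem_ae_iff]
      refine measure_mono_null (fun ω hω => ?_) h
      simp only [Set.mem_compl_iff, Set.mem_iUnion, Set.mem_ofPred_eq, not_exists] at hω ⊢
      by_contra hne
      obtain ⟨n, hn⟩ := ENat.ne_top_iff_exists.1 hne
      exact hω n hn.ge
    have := ENNReal.Tendsto.const_mul (a := EReal.exp η) (tendsto_measure_iUnion_atTop
      (μ := noChangeLaw ν) hmono) (Or.inr (by simp))
    rw [hU, mul_one] at this
    exact le_of_tendsto' this hle
  · refine le_top.trans_eq (Eq.symm ?_)
    by_contra hne
    refine h (measure_mono_null (fun ω hω => ?_) (ae_lt_top (measurable_toENNReal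
      hτ.measurableSet_lt') hne))
    simp only [Set.mem_ofPred_eq] at hω
    simp [hω]

theorem IsLLR.lintegral_exp {L : 𝒳 → EReal} {ν₁ ν₀ : ProbabilityMeasure 𝒳} (h : IsLLR L ν₁ ν₀) :
    ∫⁻ x, EReal.exp (L x) ∂(ν₀ : Measure 𝒳) = 1 := by
  have : ∀ᵐ x ∂(ν₀ : Measure 𝒳), EReal.exp (L x) =
      (ν₁ : Measure 𝒳).rnDeriv (ν₀ : Measure 𝒳) x := by
    filter_upwards [h.ae_eq] with x hx
    rw [hx, ENNReal.exp_log]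
  rw [lintegral_congr_ae this, Measure.lintegral_rnDeriv h.absolutelyContinuous, measure_univ]

theorem exp_abs_log {α : ℝ} (h0 : 0 < α) (h1 : α < 1) :
    EReal.exp (|Real.log α| : ℝ) = (ENNReal.ofReal α)⁻¹ := by
  rw [abs_of_neg (Real.log_neg h0 h1), EReal.exp_coe, Real.exp_neg, Real.exp_log h0,
    ENNReal.ofReal_inv_of_pos h0]

theorem IsCusumThreshold.inv_le_meanTimeFA {L : 𝒳 → EReal} {ν₁ ν₀ : ProbabilityMeasure 𝒳}
    (h : IsLLR L ν₁ ν₀) {α η : ℝ} (h0 : 0 < α) (h1 : α < 1) (hη : IsCusumThreshold ν₀ L α η) :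
    (ENNReal.ofReal α)⁻¹ ≤ meanTimeFA ν₀ (cusum L η) := by
  rcases hη with rfl | hη
  · rw [← exp_abs_log h0 h1]
    exact exp_le_meanTimeFA_cusum h.measurable ν₀ h.lintegral_exp _
  · exact hη.ge

/-- Calibration gives e^η ≤ E τ = 1/α. Delay bounds therefore need only the threshold |log α|. -/
theorem IsCusumThreshold.le_abs_log {L : 𝒳 → EReal} {ν₁ ν₀ : ProbabilityMeasure 𝒳}
    (h : IsLLR L ν₁ ν₀) {α η : ℝ} (h0 : 0 < α) (h1 : α < 1) (hη : IsCusumThreshold ν₀ L α η) :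
    η ≤ |Real.log α| := by
  rcases hη with rfl | hη
  · exact le_rfl
  · have := exp_le_meanTimeFA_cusum h.measurable ν₀ h.lintegral_exp η
    rw [hη, ← exp_abs_log h0 h1, EReal.exp_le_exp_iff, EReal.coe_le_coe_iff] at this
    exact this

theorem FAR_le_of_inv_le {ν : ProbabilityMeasure 𝒳} {τ : (ℕ → 𝒳) → ℕ∞} {a : ℝ≥0∞}
    (h : a⁻¹ ≤ meanTimeFA ν τ) : FAR ν τ ≤ a :=
  ENNReal.inv_le_iff_inv_le.1 h

/-! ### Wald's identity and the mean alarm time from above -/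

theorem measurable_indicator_one {Ω β : Type*} {m : MeasurableSpace Ω} [MeasurableSpace β]
    [Zero β] [One β] {s : Set Ω} (hs : MeasurableSet s) : Measurable (s.indicator (1 : Ω → β)) :=
  measurable_one.indicator hs

theorem coe_sum_le_sum_obs {α : Type*} {L : α → EReal} {Y : α → ℝ} {ω : ℕ → α}
    (h : ∀ i, (Y (ω i) : EReal) ≤ L (ω i)) (n : ℕ) :
    ((∑ i ∈ Finset.range n, Y (ω i) : ℝ) : EReal) ≤ ∑ i ∈ Finset.Icc 1 n, L (obs i ω) := by
  induction n with
  | zero => simp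
  | succ n ih =>
    rw [Finset.sum_range_succ, Finset.sum_Icc_succ_top (by omega), EReal.coe_add]
    exact add_le_add ih (h n)

theorem sum_le_of_lt_cusum {α : Type*} {L : α → EReal} {Y : α → ℝ} {ω : ℕ → α}
    (h : ∀ i, (Y (ω i) : EReal) ≤ L (ω i)) {b : ℝ} (hb : 0 ≤ b) {n : ℕ}
    (hn : (n : ℕ∞) < cusum L b ω) : ∑ i ∈ Finset.range n, Y (ω i) ≤ b := by
  rcases n.eq_zero_or_pos with rfl | hpos
  · simpa using hb
  by_contra hlt
  refine hn.not_ge (cusum_le_iff.2 ⟨n, Finset.mem_Icc.2 ⟨hpos, le_rfl⟩, 1,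
    Finset.mem_Icc.2 ⟨le_rfl, hpos⟩, le_trans ?_ (coe_sum_le_sum_obs h n)⟩)
  exact EReal.coe_le_coe_iff.2 (not_le.1 hlt).le

/-- The stopped sum overshoots b by at most its last increment. -/
theorem sum_ite_lt_le {y : ℕ → ℝ} {b c : ℝ} (hb : 0 ≤ b) (hc : 0 ≤ c) (hy : ∀ i, y i ≤ c)
    {a : ℕ∞} (h : ∀ n : ℕ, (n : ℕ∞) < a → ∑ i ∈ Finset.range n, y i ≤ b) (n : ℕ) :
    ∑ i ∈ Finset.range n, (if (i : ℕ∞) < a then y i else 0) ≤ b + c := by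
  induction n with
  | zero => simpa using add_nonneg hb hc
  | succ n ih =>
    rw [Finset.sum_range_succ]
    split_ifs with hn
    · refine add_le_add (le_trans (le_of_eq ?_) (h n hn)) (hy n)
      refine Finset.sum_congr rfl fun i hi => if_pos (lt_trans ?_ hn)
      exact Nat.cast_lt.2 (Finset.mem_range.1 hi)
    · simpa using ih

theorem integral_ite_lt_mul {τ : (ℕ → 𝒳) → ℕ∞} (hτ : IsStoppingRule τ)
    (ν : ProbabilityMeasure 𝒳) {Y : 𝒳 → ℝ} (hY : Measurable Y)
    (hYi : Integrable Y (ν : Measure 𝒳)) (n : ℕ) :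
    Integrable (fun ω => if (n : ℕ∞) < τ ω then Y (ω n) else 0) (noChangeLaw ν) ∧
    ∫ ω, (if (n : ℕ∞) < τ ω then Y (ω n) else 0) ∂(noChangeLaw ν) =
      (noChangeLaw ν).real {ω | (n : ℕ∞) < τ ω} * ∫ x, Y x ∂(ν : Measure 𝒳) := by
  have hmp : MeasurePreserving (fun ω : ℕ → 𝒳 => ω n) (noChangeLaw ν) (ν : Measure 𝒳) :=
    measurePreserving_eval_infinitePi (fun _ => (ν : Measure 𝒳)) n
  set B : Set (ℕ → 𝒳) := {ω | (n : ℕ∞) < τ ω} with hBdef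
  have hB : MeasurableSet[obsSigma 𝒳 n] B := hτ.measurableSet_lt n
  have hB' := obsSigma_le n _ hB
  have hint : Integrable (fun ω : ℕ → 𝒳 => Y (ω n)) (noChangeLaw ν) :=
    hmp.integrable_comp_of_integrable hYi
  have heq : (fun ω => if (n : ℕ∞) < τ ω then Y (ω n) else 0) =
      B.indicator fun ω : ℕ → 𝒳 => Y (ω n) := by
    ext ω
    simp [hBdef, Set.indicator_apply]
  have heq' : (fun ω => if (n : ℕ∞) < τ ω then Y (ω n) else 0) =
      (B.indicator (1 : (ℕ → 𝒳) → ℝ)) * fun ω : ℕ → 𝒳 => Y (ω n) := by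
    ext ω
    simp [hBdef, Set.indicator_apply]
  refine ⟨heq ▸ hint.indicator hB', ?_⟩
  have hind : IndepFun (B.indicator (1 : (ℕ → 𝒳) → ℝ)) (fun ω : ℕ → 𝒳 => Y (ω n))
      (noChangeLaw ν) := by
    refine (IndepFun_iff_Indep _ _ _).2 ?_
    refine indep_of_indep_of_le_left (indep_of_indep_of_le_right
      (indep_obsSigma_tailSigma (fun _ => (ν : Measure 𝒳)) n) ?_) ?_
    · exact (hY.comp (measurable_tailSigma_eval le_rfl)).comap_le
    · exact (measurable_indicator_one hB).comap_le
  have hY2 : ∫ ω, Y (ω n) ∂(noChangeLaw ν) = ∫ x, Y x ∂(ν : Measure 𝒳) := by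
    rw [← hmp.map_eq, integral_map hmp.measurable.aemeasurable hY.aestronglyMeasurable]
  rw [heq', hind.integral_mul_eq_mul_integral, hY2, integral_indicator_one hB']
  · exact (measurable_one.indicator hB').aestronglyMeasurable
  · exact hint.aestronglyMeasurable

/-- Wald's identity applied to a minorant Y of L bounded above. Working with the first n terms
avoids assuming that the mean is finite. -/
theorem meanTimeFA_cusum_le {L : 𝒳 → EReal} (hL : Measurable L) (ν : ProbabilityMeasure 𝒳)
    {Y : 𝒳 → ℝ} (hY : Measurable Y) (hYi : Integrable Y (ν : Measure 𝒳))
    (hYL : ∀ᵐ x ∂(ν : Measure 𝒳), (Y x : EReal) ≤ L x) {b c : ℝ} (hb : 0 ≤ b) (hc : 0 ≤ c)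
    (hYc : ∀ x, Y x ≤ c) (hpos : 0 < ∫ x, Y x ∂(ν : Measure 𝒳)) :
    meanTimeFA ν (cusum L b) ≤ ENNReal.ofReal ((b + c) / ∫ x, Y x ∂(ν : Measure 𝒳)) := by
  have hτ := isStoppingRule_cusum hL b
  have hae : ∀ᵐ ω ∂(noChangeLaw ν), ∀ i, (Y (ω i) : EReal) ≤ L (ω i) :=
    ae_all_iff.2 fun i => (measurePreserving_eval_infinitePi (fun _ => (ν : Measure 𝒳))
      i).quasiMeasurePreserving.ae hYL
  have hint := fun n => integral_ite_lt_mul hτ ν hY hYi n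
  rw [meanTimeFA, lintegral_toENNReal _ hτ.measurableSet_lt']
  refine ENNReal.tsum_le_of_sum_range_le fun n => ?_
  have h1 : ∫ ω, ∑ i ∈ Finset.range n, (if (i : ℕ∞) < cusum L b ω then Y (ω i) else 0)
      ∂(noChangeLaw ν) ≤ b + c := by
    have : ∫ _, (b + c) ∂(noChangeLaw ν) = b + c := by simp
    rw [← this]
    refine integral_mono_ae (integrable_finsetSum _ fun i _ => (hint i).1)
      (integrable_const _) ?_
    filter_upwards [hae] with ω hω
    exact sum_ite_lt_le hb hc (fun i => hYc (ω i)) (fun n hn => sum_le_of_lt_cusum hω hb hn) n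
  rw [integral_finsetSum _ fun i _ => (hint i).1, Finset.sum_congr rfl fun i _ => (hint i).2,
    ← Finset.sum_mul, ← le_div_iff₀ hpos] at h1
  refine le_trans (le_of_eq ?_) (ENNReal.ofReal_le_ofReal h1)
  rw [ENNReal.ofReal_sum_of_nonneg fun _ _ => measureReal_nonneg]
  exact Finset.sum_congr rfl fun i _ => (ofReal_measureReal (measure_ne_top _ _)).symm

/-! ### Worst-case delay of CUSUM: restarting at the change point -/

theorem map_shift_changeLaw (ν₀ ν₁ : ProbabilityMeasure 𝒳) (n : ℕ) :
    (changeLaw ν₀ ν₁ (n + 1)).map (fun ω i => ω (i + n)) = noChangeLaw ν₁ := by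
  have := Measure.map_infinitePi_infinitePi_of_inj
    (P := fun i : ℕ => ((if i + 1 < n + 1 then ν₀ else ν₁ : ProbabilityMeasure 𝒳) : Measure 𝒳))
    (add_left_injective n)
  rw [changeLaw, noChangeLaw, this]
  congr 1
  funext i
  rw [if_neg (by omega)]

theorem WDD_cusum_le_meanTimeFA {L : 𝒳 → EReal} (hL : Measurable L)
    (ν₀ ν₁ : ProbabilityMeasure 𝒳) (η : ℝ) :
    WDD ν₀ ν₁ (cusum L η) ≤ meanTimeFA ν₁ (cusum L η) := by
  refine iSup₂_le fun m hm => essSup_le_of_ae_le _ ?_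
  obtain ⟨n, rfl⟩ : ∃ n, m = n + 1 := ⟨m - 1, by omega⟩
  set T : (ℕ → 𝒳) → (ℕ → 𝒳) := fun ω i => ω (i + n) with hT
  have hτm : Measurable fun ω : ℕ → 𝒳 => (cusum L η ω : ℝ≥0∞) :=
    measurable_toENNReal (isStoppingRule_cusum hL η).measurableSet_lt'
  have hTm : Measurable[tailSigma 𝒳 n] T := measurable_tailSigma_shift n
  have hTm' : Measurable T := hTm.mono (tailSigma_le _) le_rfl
  have hmap : (changeLaw ν₀ ν₁ (n + 1)).map T = noChangeLaw ν₁ := map_shift_changeLaw ν₀ ν₁ n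
  have hY : ∫⁻ ω, (cusum L η (T ω) : ℝ≥0∞) ∂(changeLaw ν₀ ν₁ (n + 1)) = meanTimeFA ν₁ (cusum L η) := by
    rw [meanTimeFA, ← hmap, lintegral_map hτm hTm']
  have hle : (fun ω => ((cusum L η ω + 1 - ((n + 1 : ℕ) : ℕ∞) : ℕ∞) : ℝ≥0∞)) ≤ᵐ[changeLaw ν₀ ν₁ (n + 1)]
      fun ω => (cusum L η (T ω) : ℝ≥0∞) :=
    ae_of_all _ fun ω => ENat.toENNReal_le.2 (cusum_add_one_sub_le L η hm ω)
  -- The restarted alarm time depends only on coordinates from n on, so its conditional expectation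
  -- given F_n is constant.
  have hconst := ae_eq_condLExp (Y := fun _ => meanTimeFA ν₁ (cusum L η))
    ((obsFiltration 𝒳).le n) (changeLaw ν₀ ν₁ (n + 1))
    (fun ω => (cusum L η (T ω) : ℝ≥0∞)) measurable_const (fun s hs => by
      have hs' := obsSigma_le _ _ hs
      have hpt : ∀ ω, s.indicator (fun ω => (cusum L η (T ω) : ℝ≥0∞)) ω =
          s.indicator 1 ω * (cusum L η (T ω) : ℝ≥0∞) := fun ω => by
        by_cases h : ω ∈ s <;> simp [h]
      have hg : Measurable[tailSigma 𝒳 n] fun ω => (cusum L η (T ω) : ℝ≥0∞) :=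
        hτm.comp hTm
      rw [setLIntegral_const, ← lintegral_indicator hs', lintegral_congr hpt, changeLaw,
        lintegral_mul_eq_lintegral_mul_lintegral_of_independent_measurableSpace
          (f := s.indicator 1) (g := fun ω => (cusum L η (T ω) : ℝ≥0∞)) (obsSigma_le n)
          (tailSigma_le n) (indep_obsSigma_tailSigma _ n)
          (measurable_indicator_one hs) hg,
        ← changeLaw, hY, lintegral_indicator_one hs', mul_comm])
  filter_upwards [condLExp_mono (mΩ := obsFiltration 𝒳 n) hle, hconst] with ω h1 h2
  exact h1.trans_eq h2.symm

/-! ### Log-likelihood ratios, divergences and the positive drift -/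

theorem StochLarger.map_Ioi_le {L : 𝒳 → EReal} (hL : Measurable L) {ν ν' : Measure 𝒳}
    (h : StochLarger (ν.map L) (ν'.map L)) : ν' {x | 0 < L x} ≤ ν {x | 0 < L x} := by
  have := h.measure_Ioi_le 0
  rwa [Measure.map_apply hL measurableSet_Ioi, Measure.map_apply hL measurableSet_Ioi] at this

/-- The density exceeds 1 exactly where L > 0. If that set had positive ν₀-mass, ν₁ would charge it
strictly more; so the density is at most 1, has integral 1, and equals 1 a.e. -/
theorem IsLLR.eq_of_measure_pos_le {L : 𝒳 → EReal} {ν₁ ν₀ : ProbabilityMeasure 𝒳}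
    (h : IsLLR L ν₁ ν₀) (hle : (ν₁ : Measure 𝒳) {x | 0 < L x} ≤ (ν₀ : Measure 𝒳) {x | 0 < L x}) :
    ν₁ = ν₀ := by
  set r := (ν₁ : Measure 𝒳).rnDeriv (ν₀ : Measure 𝒳) with hr
  have hrm : Measurable r := Measure.measurable_rnDeriv _ _
  have hA : MeasurableSet {x | 0 < L x} := measurableSet_lt measurable_const h.measurable
  have hLr : ∀ᵐ x ∂(ν₀ : Measure 𝒳), 0 < L x ↔ 1 < r x := by
    filter_upwards [h.ae_eq] with x hx
    rw [hx, ENNReal.zero_lt_log_iff]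
  have hzero : (ν₀ : Measure 𝒳) {x | 0 < L x} = 0 := by
    by_contra hne
    have hlt : ∫⁻ _ in {x | 0 < L x}, 1 ∂(ν₀ : Measure 𝒳) <
        ∫⁻ x in {x | 0 < L x}, r x ∂(ν₀ : Measure 𝒳) := by
      refine setLIntegral_strict_mono hA hne hrm (by simp) ?_
      filter_upwards [hLr] with x hx h0 using hx.1 h0
    rw [Measure.setLIntegral_rnDeriv h.absolutelyContinuous, setLIntegral_one] at hlt
    exact hlt.not_ge hle
  have hr1 : r ≤ᵐ[(ν₀ : Measure 𝒳)] 1 := by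
    have : ∀ᵐ x ∂(ν₀ : Measure 𝒳), ¬ 0 < L x := by
      rw [ae_iff]
      simpa using hzero
    filter_upwards [this, hLr] with x hx hx'
    exact not_lt.1 fun hlt => hx (hx'.2 hlt)
  have hr1' : r =ᵐ[(ν₀ : Measure 𝒳)] 1 := by
    refine ae_eq_of_ae_le_of_lintegral_le hr1 ?_ aemeasurable_const ?_
    · rw [Measure.lintegral_rnDeriv h.absolutelyContinuous]
      simp
    · rw [Measure.lintegral_rnDeriv h.absolutelyContinuous]
      simp
  apply Subtype.ext
  change (ν₁ : Measure 𝒳) = (ν₀ : Measure 𝒳)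
  rw [← Measure.withDensity_rnDeriv_eq _ _ h.absolutelyContinuous, ← hr,
    withDensity_congr_ae hr1', withDensity_one]

theorem KL_toReal {ν₁ ν₀ : ProbabilityMeasure 𝒳} (h : KL ν₁ ν₀ ≠ ∞) :
    (KL ν₁ ν₀).toReal = ∫ x, llr (ν₁ : Measure 𝒳) (ν₀ : Measure 𝒳) x ∂(ν₁ : Measure 𝒳) :=
  toReal_klDiv_of_measure_eq (klDiv_ne_top_iff.1 h).1 (by simp)

/-- Chain rule dν/dν₀bar = dν/dν₁bar · dν₁bar/dν₀bar; ν-a.e. all factors lie in (0, ∞), so the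
logarithm splits. -/
theorem IsLLR.ae_eq_llr_sub {L : 𝒳 → EReal} {ν₁bar ν₀bar ν : ProbabilityMeasure 𝒳}
    (h : IsLLR L ν₁bar ν₀bar) (h₀ : (ν : Measure 𝒳) ≪ (ν₀bar : Measure 𝒳))
    (h₁ : (ν : Measure 𝒳) ≪ (ν₁bar : Measure 𝒳)) :
    ∀ᵐ x ∂(ν : Measure 𝒳), L x = ((L x).toReal : EReal) ∧
      (L x).toReal = llr (ν : Measure 𝒳) (ν₀bar : Measure 𝒳) x -
        llr (ν : Measure 𝒳) (ν₁bar : Measure 𝒳) x := by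
  filter_upwards [h₀ h.ae_eq, h₀ (Measure.rnDeriv_lt_top (ν₁bar : Measure 𝒳) (ν₀bar : Measure 𝒳)),
    h₁ (Measure.rnDeriv_pos h.absolutelyContinuous),
    h₁ (Measure.rnDeriv_lt_top (ν : Measure 𝒳) (ν₁bar : Measure 𝒳)), Measure.rnDeriv_pos h₁,
    h₀ (Measure.rnDeriv_mul_rnDeriv (κ := (ν₀bar : Measure 𝒳)) h₁)] with x hL hr hr0 hp hp0 hq
  rw [ENNReal.log_pos_real hr0.ne' hr.ne] at hL
  rw [hL, EReal.toReal_coe]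
  refine ⟨rfl, ?_⟩
  rw [llr, llr, ← hq, Pi.mul_apply, ENNReal.toReal_mul, Real.log_mul]
  · ring
  · exact (ENNReal.toReal_pos hp0.ne' hp.ne).ne'
  · exact (ENNReal.toReal_pos hr0.ne' hr.ne).ne'

theorem IsLLR.lintegral_exp_neg_le {L : 𝒳 → EReal} {ν₁ ν₀ : ProbabilityMeasure 𝒳}
    (h : IsLLR L ν₁ ν₀) : ∫⁻ x, EReal.exp (-L x) ∂(ν₁ : Measure 𝒳) ≤ 1 := by
  have hm : Measurable fun x => EReal.exp (-L x) := EReal.measurable_exp.comp h.measurable.neg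
  rw [← lintegral_rnDeriv_mul h.absolutelyContinuous hm.aemeasurable]
  have : ∫⁻ _, 1 ∂(ν₀ : Measure 𝒳) = 1 := by simp
  rw [← this]
  -- Only an inequality: the product of the density and its inverse is 0 where the density vanishes.
  refine lintegral_mono_ae ?_
  filter_upwards [h.ae_eq] with x hx
  rw [hx, EReal.exp_neg, ENNReal.exp_log]
  exact ENNReal.mul_inv_le_one _

theorem IsLLR.integrable_toReal
    {ν₀bar ν₁bar ν₁ : ProbabilityMeasure 𝒳} {L : 𝒳 → EReal} (h : IsLLR L ν₁bar ν₀bar)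
    (hfin₀ : KL ν₁ ν₀bar ≠ ∞) (hfin₁ : KL ν₁ ν₁bar ≠ ∞) :
    Integrable (fun x => (L x).toReal) (ν₁ : Measure 𝒳) := by
  have h₀ := klDiv_ne_top_iff.1 hfin₀
  have h₁ := klDiv_ne_top_iff.1 hfin₁
  refine (h₀.2.sub h₁.2).congr ?_
  filter_upwards [h.ae_eq_llr_sub h₀.1 h₁.1] with x hx using hx.2.symm

theorem IsLLR.integral_toReal {ν₀bar ν₁bar ν₁ : ProbabilityMeasure 𝒳} {L : 𝒳 → EReal}
    (h : IsLLR L ν₁bar ν₀bar) (hfin₀ : KL ν₁ ν₀bar ≠ ∞) (hfin₁ : KL ν₁ ν₁bar ≠ ∞) :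
    ∫ x, (L x).toReal ∂(ν₁ : Measure 𝒳) = (KL ν₁ ν₀bar).toReal - (KL ν₁ ν₁bar).toReal := by
  have h₀ := klDiv_ne_top_iff.1 hfin₀
  have h₁ := klDiv_ne_top_iff.1 hfin₁
  rw [KL_toReal hfin₀, KL_toReal hfin₁, ← integral_sub h₀.2 h₁.2]
  refine integral_congr_ae ?_
  filter_upwards [h.ae_eq_llr_sub h₀.1 h₁.1] with x hx using hx.2

theorem JointlyStochBounded.integral_toReal_pos {P₀ P₁ : Set (ProbabilityMeasure 𝒳)}
    {ν₀bar ν₁bar : ProbabilityMeasure 𝒳} {L : 𝒳 → EReal}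
    (h : JointlyStochBounded P₀ P₁ ν₀bar ν₁bar L) (hne : ν₁bar ≠ ν₀bar)
    {ν₁ : ProbabilityMeasure 𝒳} (hν₁ : ν₁ ∈ P₁)
    (hfin₀ : KL ν₁ ν₀bar ≠ ∞) (hfin₁ : KL ν₁ ν₁bar ≠ ∞) :
    0 < ∫ x, (L x).toReal ∂(ν₁ : Measure 𝒳) := by
  have hL := h.isLLR.measurable
  have hae := h.isLLR.ae_eq_llr_sub (klDiv_ne_top_iff.1 hfin₀).1 (klDiv_ne_top_iff.1 hfin₁).1
  have hZi : Integrable (fun x => (L x).toReal) (ν₁ : Measure 𝒳) :=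
    h.isLLR.integrable_toReal hfin₀ hfin₁
  have hZm : Measurable fun x => (L x).toReal := hL.ereal_toReal
  have hanti : Antitone fun t : EReal => EReal.exp (-t) := fun s t hst =>
    EReal.exp_monotone (EReal.neg_le_neg_iff.2 hst)
  have hexp : ∫⁻ x, EReal.exp (-L x) ∂(ν₁ : Measure 𝒳) ≤ 1 := by
    have i1 := Measure.isProbabilityMeasure_map (μ := (ν₁ : Measure 𝒳)) hL.aemeasurable
    have i2 := Measure.isProbabilityMeasure_map (μ := (ν₁bar : Measure 𝒳)) hL.aemeasurable
    have := (h.larger₁ ν₁ hν₁).lintegral_antitone_le hanti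
    rw [lintegral_map hanti.measurable hL, lintegral_map hanti.measurable hL] at this
    exact this.trans h.isLLR.lintegral_exp_neg_le
  have hexp' : ∫⁻ x, ENNReal.ofReal (Real.exp (-(L x).toReal)) ∂(ν₁ : Measure 𝒳) ≤ 1 := by
    refine le_trans (le_of_eq (lintegral_congr_ae ?_)) hexp
    filter_upwards [hae] with x hx
    conv_rhs => rw [hx.1, ← EReal.coe_neg, EReal.exp_coe]
  have hEm : Measurable fun x => Real.exp (-(L x).toReal) := hZm.neg.exp
  have hEi : Integrable (fun x => Real.exp (-(L x).toReal)) (ν₁ : Measure 𝒳) := by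
    refine (lintegral_ofReal_ne_top_iff_integrable hEm.aestronglyMeasurable
      (ae_of_all _ fun x => (Real.exp_pos _).le)).1 (ne_top_of_le_ne_top ENNReal.one_ne_top hexp')
  have hE1 : ∫ x, Real.exp (-(L x).toReal) ∂(ν₁ : Measure 𝒳) ≤ 1 := by
    rw [integral_eq_lintegral_of_nonneg_ae (ae_of_all _ fun x => (Real.exp_pos _).le)
      hEm.aestronglyMeasurable]
    exact ENNReal.toReal_le_of_le_ofReal zero_le_one (by simpa using hexp')
  by_contra hneg
  -- exp(−z) − 1 + z is nonnegative and vanishes only at z = 0; a nonpositive drift makes its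
  -- integral zero.
  have hnn : ∀ x, 0 ≤ Real.exp (-(L x).toReal) - 1 + (L x).toReal := fun x => by
    have := Real.add_one_le_exp (-(L x).toReal)
    linarith
  have hsi : Integrable (fun x => Real.exp (-(L x).toReal) - 1 + (L x).toReal)
      (ν₁ : Measure 𝒳) := (hEi.sub (integrable_const 1)).add hZi
  have hint : ∫ x, (Real.exp (-(L x).toReal) - 1 + (L x).toReal) ∂(ν₁ : Measure 𝒳) = 0 := by
    refine le_antisymm ?_ (integral_nonneg hnn)
    have hE1i : Integrable (fun x => Real.exp (-(L x).toReal) - 1) (ν₁ : Measure 𝒳) :=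
      hEi.sub (integrable_const 1)
    rw [integral_add hE1i hZi, integral_sub hEi (integrable_const 1)]
    simp only [integral_const, probReal_univ, smul_eq_mul, mul_one]
    linarith
  have hzero := (integral_eq_zero_iff_of_nonneg hnn hsi).1 hint
  have hL0 : (ν₁ : Measure 𝒳) {x | 0 < L x} = 0 := by
    have : ∀ᵐ x ∂(ν₁ : Measure 𝒳), ¬ 0 < L x := by
      filter_upwards [hae, hzero] with x hx hx'
      have hz : (L x).toReal = 0 := by
        by_contra hz
        have := Real.add_one_lt_exp (neg_ne_zero.2 hz)
        simp only [Pi.zero_apply] at hx'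
        linarith
      rw [hx.1, hz]
      simp
    simpa [ae_iff] using this
  refine hne (h.isLLR.eq_of_measure_pos_le ?_)
  rw [le_zero_iff.1 (((h.larger₁ ν₁ hν₁).map_Ioi_le hL).trans hL0.le)]
  exact zero_le

/-- A common element would be squeezed: ν₁bar(L > 0) ≤ ν(L > 0) ≤ ν₀bar(L > 0). This makes D(ν₁‖ν₀)
nonzero. -/
theorem JointlyStochBounded.ne {P₀ P₁ : Set (ProbabilityMeasure 𝒳)}
    {ν₀bar ν₁bar : ProbabilityMeasure 𝒳} {L : 𝒳 → EReal}
    (h : JointlyStochBounded P₀ P₁ ν₀bar ν₁bar L) (hne : ν₁bar ≠ ν₀bar)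
    {ν₀ ν₁ : ProbabilityMeasure 𝒳} (hν₀ : ν₀ ∈ P₀) (hν₁ : ν₁ ∈ P₁) : ν₁ ≠ ν₀ := by
  rintro rfl
  have hL := h.isLLR.measurable
  exact hne (h.isLLR.eq_of_measure_pos_le
    (((h.larger₁ ν₁ hν₁).map_Ioi_le hL).trans ((h.larger₀ ν₁ hν₀).map_Ioi_le hL)))

/-! ### Lower bound for the delay of an arbitrary rule -/

theorem tsum_indicator_window_le (a : ℕ∞) (w : ℕ) :
    ∑' n : ℕ, (if (n : ℕ∞) < a ∧ a ≤ (n + w : ℕ) then (1 : ℝ≥0∞) else 0) ≤ w := by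
  induction a with
  | top => simp
  | coe k =>
    rw [tsum_eq_sum (s := Finset.Ico (k - w) k)]
    · refine (Finset.sum_le_sum (g := fun _ => 1) fun n _ => by split_ifs <;> simp).trans ?_
      simp only [Finset.sum_const, Nat.card_Ico, nsmul_eq_mul, mul_one, Nat.cast_le]
      omega
    · intro n hn
      rw [Finset.mem_Ico] at hn
      simp only [Nat.cast_lt, Nat.cast_le, ite_eq_right_iff, one_ne_zero, imp_false]
      omega

/-- Averaging: a path stops in at most w of the windows (n, n + w], while ∑ P(n < τ) = E τ ≥ 1/a. If
every window failed, summation would give 2w ≤ w. -/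
theorem exists_window {τ : (ℕ → 𝒳) → ℕ∞} (hτ : IsStoppingRule τ) {ν₀ : ProbabilityMeasure 𝒳}
    {a : ℝ≥0∞} (ha0 : a ≠ 0) (ha : a ≠ ∞) (hfar : FAR ν₀ τ ≤ a) {w : ℕ} (hw : 0 < w) :
    ∃ n : ℕ, noChangeLaw ν₀ {ω | (n : ℕ∞) < τ ω} ≠ 0 ∧
      noChangeLaw ν₀ {ω | (n : ℕ∞) < τ ω ∧ τ ω ≤ (n + w : ℕ)} ≤
        2 * w * a * noChangeLaw ν₀ {ω | (n : ℕ∞) < τ ω} := by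
  by_contra! hcon
  have hle : ∀ n : ℕ, 2 * w * a * noChangeLaw ν₀ {ω | (n : ℕ∞) < τ ω} ≤
      noChangeLaw ν₀ {ω | (n : ℕ∞) < τ ω ∧ τ ω ≤ (n + w : ℕ)} := fun n => by
    rcases eq_or_ne (noChangeLaw ν₀ {ω | (n : ℕ∞) < τ ω}) 0 with h | h
    · simp [h]
    · exact (hcon n h).le
  have hm : ∀ n : ℕ, MeasurableSet {ω | (n : ℕ∞) < τ ω ∧ τ ω ≤ (n + w : ℕ)} := fun n =>
    (hτ.measurableSet_lt' n).inter (obsSigma_le _ _ (hτ (n + w)))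
  have hsum : ∑' n : ℕ, noChangeLaw ν₀ {ω | (n : ℕ∞) < τ ω ∧ τ ω ≤ (n + w : ℕ)} ≤ w := by
    have hi : ∀ n : ℕ, noChangeLaw ν₀ {ω | (n : ℕ∞) < τ ω ∧ τ ω ≤ (n + w : ℕ)} =
        ∫⁻ ω, (if (n : ℕ∞) < τ ω ∧ τ ω ≤ (n + w : ℕ) then (1 : ℝ≥0∞) else 0)
          ∂(noChangeLaw ν₀) := fun n => by
      rw [← lintegral_indicator_one (hm n)]
      refine lintegral_congr fun ω => ?_
      simp [Set.indicator_apply]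
    simp only [hi]
    rw [← lintegral_tsum fun n =>
      (Measurable.ite (hm n) measurable_const measurable_const).aemeasurable]
    refine (lintegral_mono fun ω => tsum_indicator_window_le (τ ω) w).trans ?_
    simp
  have hmean : a⁻¹ ≤ ∑' n : ℕ, noChangeLaw ν₀ {ω | (n : ℕ∞) < τ ω} := by
    rw [← lintegral_toENNReal _ hτ.measurableSet_lt']
    exact ENNReal.inv_le_iff_inv_le.1 hfar
  have h2 : (2 * w : ℝ≥0∞) ≤ w := by
    calc (2 * w : ℝ≥0∞) = 2 * w * a * a⁻¹ := by
          rw [mul_assoc _ a, ENNReal.mul_inv_cancel ha0 ha, mul_one]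
      _ ≤ 2 * w * a * ∑' n : ℕ, noChangeLaw ν₀ {ω | (n : ℕ∞) < τ ω} := by gcongr
      _ ≤ w := by
          rw [← ENNReal.tsum_mul_left]
          exact (ENNReal.tsum_le_tsum hle).trans hsum
  have h3 : 2 * w ≤ w := by exact_mod_cast h2
  omega

theorem changeLaw_apply_eq_noChangeLaw (ν₀ ν₁ : ProbabilityMeasure 𝒳) {n : ℕ} {A : Set (ℕ → 𝒳)}
    (hA : MeasurableSet[obsSigma 𝒳 n] A) :
    changeLaw ν₀ ν₁ (n + 1) A = noChangeLaw ν₀ A :=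
  infinitePi_apply_congr (fun i hi => by rw [if_pos (by omega)]) hA

theorem changeLaw_inter_le {ν₀ ν₁ : ProbabilityMeasure 𝒳}
    (hac : (ν₁ : Measure 𝒳) ≪ (ν₀ : Measure 𝒳)) {n w : ℕ} {A : Set (ℕ → 𝒳)}
    (hA : MeasurableSet[obsSigma 𝒳 (n + w)] A) (c : ℝ≥0∞) :
    changeLaw ν₀ ν₁ (n + 1) (A ∩ {ω | ∏ i ∈ Finset.Ico n (n + w),
        (ν₁ : Measure 𝒳).rnDeriv (ν₀ : Measure 𝒳) (ω i) ≤ c}) ≤ c * noChangeLaw ν₀ A := by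
  set f := (ν₁ : Measure 𝒳).rnDeriv (ν₀ : Measure 𝒳) with hf
  have hfm : Measurable f := Measure.measurable_rnDeriv _ _
  set C : Set (ℕ → 𝒳) := {ω | ∏ i ∈ Finset.Ico n (n + w), f (ω i) ≤ c} with hC
  have hCm : MeasurableSet[obsSigma 𝒳 (n + w)] C :=
    measurableSet_le (Finset.measurable_prod _ fun i hi =>
      hfm.comp (measurable_obsSigma_eval (Finset.mem_Ico.1 hi).2)) measurable_const
  have hAC := hA.inter hCm
  -- Coordinates after the window do not affect the event, so they may be given law ν₀; the density
  -- is then a finite product.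
  have h1 : changeLaw ν₀ ν₁ (n + 1) (A ∩ C) = Measure.infinitePi (fun i : ℕ =>
      ((if i ∈ Finset.Ico n (n + w) then ν₁ else ν₀ : ProbabilityMeasure 𝒳) : Measure 𝒳))
      (A ∩ C) := by
    refine infinitePi_apply_congr (fun i hi => ?_) hAC
    simp only [Finset.mem_Ico]
    by_cases h : i < n
    · rw [if_pos (by omega), if_neg (by omega)]
    · rw [if_neg (by omega), if_pos (by omega)]
  have h2 := infinitePi_withDensity_prod (fun _ => (ν₀ : Measure 𝒳)) (fun i : ℕ =>
      ((if i ∈ Finset.Ico n (n + w) then ν₁ else ν₀ : ProbabilityMeasure 𝒳) : Measure 𝒳))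
      f hfm (Finset.Ico n (n + w))
      (fun i hi => by rw [if_pos hi, hf, Measure.withDensity_rnDeriv_eq _ _ hac])
      (fun i hi => by rw [if_neg hi])
  rw [h1, ← h2, withDensity_apply _ (obsSigma_le _ _ hAC)]
  calc ∫⁻ ω in A ∩ C, ∏ i ∈ Finset.Ico n (n + w), f (ω i) ∂(noChangeLaw ν₀)
      ≤ ∫⁻ _ in A ∩ C, c ∂(noChangeLaw ν₀) :=
        setLIntegral_mono' (obsSigma_le _ _ hAC) fun ω hω => hω.2
    _ = c * noChangeLaw ν₀ (A ∩ C) := setLIntegral_const _ _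
    _ ≤ c * noChangeLaw ν₀ A := by gcongr; exact Set.inter_subset_left

theorem changeLaw_inter_shift (ν₀ ν₁ : ProbabilityMeasure 𝒳) {n : ℕ} {B D : Set (ℕ → 𝒳)}
    (hB : MeasurableSet[obsSigma 𝒳 n] B) (hD : MeasurableSet D) :
    changeLaw ν₀ ν₁ (n + 1) (B ∩ (fun ω i => ω (i + n)) ⁻¹' D) =
      changeLaw ν₀ ν₁ (n + 1) B * noChangeLaw ν₁ D := by
  rw [← map_shift_changeLaw ν₀ ν₁ n, Measure.map_apply
    ((measurable_tailSigma_shift n).mono (tailSigma_le n) le_rfl) hD]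
  exact (Indep_iff _ _ _).1 (indep_obsSigma_tailSigma _ n) _ _ hB (measurable_tailSigma_shift n hD)

theorem setLIntegral_le_WDD (ν₀ ν₁ : ProbabilityMeasure 𝒳) (τ : (ℕ → 𝒳) → ℕ∞) {n : ℕ}
    {B : Set (ℕ → 𝒳)} (hB : MeasurableSet[obsSigma 𝒳 n] B) :
    ∫⁻ ω in B, ((τ ω + 1 - ((n + 1 : ℕ) : ℕ∞) : ℕ∞) : ℝ≥0∞) ∂(changeLaw ν₀ ν₁ (n + 1)) ≤
      WDD ν₀ ν₁ τ * changeLaw ν₀ ν₁ (n + 1) B := by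
  rw [← setLIntegral_condLExp ((obsFiltration 𝒳).le n) _ _ hB, ← setLIntegral_const]
  refine lintegral_mono_ae (ae_restrict_of_ae ?_)
  filter_upwards [ENNReal.ae_le_essSup (condLExp (obsFiltration 𝒳 n) (changeLaw ν₀ ν₁ (n + 1))
    fun ω => ((τ ω + 1 - ((n + 1 : ℕ) : ℕ∞) : ℕ∞) : ℝ≥0∞))] with ω hω
  refine hω.trans ?_
  exact le_iSup₂ (f := fun (m : ℕ) (_ : 1 ≤ m) => essSup
    (condLExp (obsFiltration 𝒳 (m - 1)) (changeLaw ν₀ ν₁ m)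
      fun ω => ((τ ω + 1 - (m : ℕ∞) : ℕ∞) : ℝ≥0∞)) (changeLaw ν₀ ν₁ m)) (n + 1) (by omega)

/-- Given no stop by n, three cases after a change at n + 1: a stop in the window with likelihood
ratio at most c (change of measure), a ratio above c (independent of the past), or no stop, which
costs a delay of at least w. The delay is added on the right to avoid truncated subtraction. -/
theorem natCast_le_add_WDD {ν₀ ν₁ : ProbabilityMeasure 𝒳}
    (hac : (ν₁ : Measure 𝒳) ≪ (ν₀ : Measure 𝒳)) {τ : (ℕ → 𝒳) → ℕ∞} (hτ : IsStoppingRule τ)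
    {a : ℝ≥0∞} (ha0 : a ≠ 0) (ha : a ≠ ∞) (hfar : FAR ν₀ τ ≤ a) {w : ℕ} (hw : 0 < w)
    (c : ℝ≥0∞) :
    (w : ℝ≥0∞) ≤ w * (c * (2 * w * a) + noChangeLaw ν₁ {ω | c < ∏ i ∈ Finset.range w,
      (ν₁ : Measure 𝒳).rnDeriv (ν₀ : Measure 𝒳) (ω i)}) + WDD ν₀ ν₁ τ := by
  obtain ⟨n, hn0, hn⟩ := exists_window hτ ha0 ha hfar hw
  set f := (ν₁ : Measure 𝒳).rnDeriv (ν₀ : Measure 𝒳) with hf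
  have hfm : Measurable f := Measure.measurable_rnDeriv _ _
  set P := changeLaw ν₀ ν₁ (n + 1) with hP
  set D : Set (ℕ → 𝒳) := {ω | c < ∏ i ∈ Finset.range w, f (ω i)} with hD
  have hDm : MeasurableSet D := measurableSet_lt measurable_const
    (Finset.measurable_prod _ fun i _ => hfm.comp (measurable_pi_apply i))
  set B : Set (ℕ → 𝒳) := {ω | (n : ℕ∞) < τ ω} with hB
  have hBm : MeasurableSet[obsSigma 𝒳 n] B := hτ.measurableSet_lt n
  have hPB : P B = noChangeLaw ν₀ B := changeLaw_apply_eq_noChangeLaw ν₀ ν₁ hBm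
  set A : Set (ℕ → 𝒳) := {ω | (n : ℕ∞) < τ ω ∧ τ ω ≤ (n + w : ℕ)} with hA
  have hAm : MeasurableSet[obsSigma 𝒳 (n + w)] A :=
    ((obsFiltration 𝒳).mono (Nat.le_add_right n w) _ hBm).inter (hτ (n + w))
  set E : Set (ℕ → 𝒳) := {ω | ((n + w : ℕ) : ℕ∞) < τ ω} with hE
  have hEm : MeasurableSet E := hτ.measurableSet_lt' (n + w)
  have hEB : E ⊆ B := fun ω hω =>
    show (n : ℕ∞) < τ ω from lt_of_le_of_lt (Nat.cast_le.2 (Nat.le_add_right n w)) hω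
  have hcover : B ⊆ (A ∩ {ω | ∏ i ∈ Finset.Ico n (n + w), f (ω i) ≤ c}) ∪
      (B ∩ (fun (ω : ℕ → 𝒳) i => ω (i + n)) ⁻¹' D) ∪ E := by
    intro ω hω
    by_cases h1 : ω ∈ E
    · exact Or.inr h1
    refine Or.inl ?_
    by_cases h2 : ∏ i ∈ Finset.Ico n (n + w), f (ω i) ≤ c
    · exact Or.inl ⟨⟨hω, not_lt.1 h1⟩, h2⟩
    · refine Or.inr ⟨hω, ?_⟩
      have : ∏ i ∈ Finset.range w, f (ω (i + n)) = ∏ i ∈ Finset.Ico n (n + w), f (ω i) := by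
        rw [Finset.prod_Ico_eq_prod_range, Nat.add_sub_cancel_left]
        simp only [add_comm]
      simp only [hD, Set.mem_preimage, Set.mem_ofPred_eq, this]
      exact not_le.1 h2
  have hWE : w * P E ≤ WDD ν₀ ν₁ τ * P B := by
    refine le_trans ?_ (setLIntegral_le_WDD ν₀ ν₁ τ hBm)
    refine le_trans ?_ (lintegral_mono_set hEB)
    rw [← setLIntegral_const]
    refine setLIntegral_mono' hEm fun ω hω => ?_
    have : ((w : ℕ) : ℕ∞) ≤ τ ω + 1 - ((n + 1 : ℕ) : ℕ∞) := by
      refine ENat.le_sub_of_add_le_right (ENat.natCast_ne_top _) ?_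
      refine le_trans (le_of_eq ?_) (add_le_add_left (le_of_lt hω) 1)
      push_cast
      ring
    simpa using ENat.toENNReal_le.2 this
  have hPB0 : P B ≠ 0 := hPB ▸ hn0
  have hmain : P B ≤ (c * (2 * w * a) + noChangeLaw ν₁ D) * P B + P E := by
    calc P B ≤ P (A ∩ {ω | ∏ i ∈ Finset.Ico n (n + w), f (ω i) ≤ c}) +
          P (B ∩ (fun (ω : ℕ → 𝒳) i => ω (i + n)) ⁻¹' D) + P E :=
        (measure_mono hcover).trans ((measure_union_le _ _).trans
          (add_le_add_left (measure_union_le _ _) _))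
      _ ≤ c * (2 * w * a * P B) + P B * noChangeLaw ν₁ D + P E := by
        gcongr
        · refine (changeLaw_inter_le hac hAm c).trans ?_
          rw [hPB]
          gcongr
        · exact (changeLaw_inter_shift ν₀ ν₁ hBm hDm).le
      _ = (c * (2 * w * a) + noChangeLaw ν₁ D) * P B + P E := by ring
  rw [← ENNReal.mul_le_mul_iff_left hPB0 (measure_ne_top P B)]
  calc (w : ℝ≥0∞) * P B ≤ w * ((c * (2 * w * a) + noChangeLaw ν₁ D) * P B + P E) := by gcongr
    _ = w * (c * (2 * w * a) + noChangeLaw ν₁ D) * P B + w * P E := by ring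
    _ ≤ w * (c * (2 * w * a) + noChangeLaw ν₁ D) * P B + WDD ν₀ ν₁ τ * P B := by gcongr
    _ = _ := by ring

/-- Zero delay at m = 1 gives τ = 0 for some path; F_0 is trivial, so τ = 0 everywhere and the false
alarm rate is infinite. No absolute continuity is needed, which matters when D(ν₁‖ν₀) = ∞. -/
theorem WDD_ne_zero {ν₀ ν₁ : ProbabilityMeasure 𝒳} {τ : (ℕ → 𝒳) → ℕ∞} (hτ : IsStoppingRule τ)
    {a : ℝ≥0∞} (ha : a ≠ ∞) (hfar : FAR ν₀ τ ≤ a) : WDD ν₀ ν₁ τ ≠ 0 := by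
  intro h0
  have h := setLIntegral_le_WDD ν₀ ν₁ τ (n := 0) MeasurableSet.univ
  rw [h0, zero_mul, setLIntegral_univ] at h
  have hm : Measurable fun ω => ((τ ω : ℕ∞) : ℝ≥0∞) := measurable_toENNReal hτ.measurableSet_lt'
  have hone : ∀ t : ℕ∞, t + 1 - ((0 + 1 : ℕ) : ℕ∞) = t := fun t => by
    rw [zero_add, Nat.cast_one]
    exact (ENat.addLECancellable_of_ne_top ENat.one_ne_top).add_tsub_cancel_right
  simp only [hone] at h
  have hae := (lintegral_eq_zero_iff hm).1 (le_zero_iff.1 h)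
  obtain ⟨ω, hω⟩ := hae.exists
  have hset : MeasurableSet[obsSigma 𝒳 0] {ω | τ ω ≤ (0 : ℕ)} := hτ 0
  have hbot : obsSigma 𝒳 0 = ⊥ := by simp [obsSigma]
  rw [hbot, MeasurableSpace.measurableSet_bot_iff] at hset
  have hmem : ω ∈ {ω | τ ω ≤ (0 : ℕ)} := by
    simp only [Set.mem_ofPred_eq]
    simpa using hω
  have huniv : {ω | τ ω ≤ (0 : ℕ)} = Set.univ := by
    rcases hset with hset | hset
    · rw [hset] at hmem
      exact hmem.elim
    · exact hset
  have hτ0 : ∀ ω, τ ω = 0 := fun ω => by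
    have : ω ∈ {ω | τ ω ≤ (0 : ℕ)} := huniv ▸ Set.mem_univ ω
    simpa using this
  refine ha (top_le_iff.1 (le_trans (le_of_eq ?_) hfar))
  simp [FAR, meanTimeFA, hτ0]

/-! ### Law of large numbers and the asymptotic lower bound -/

theorem tendsto_measure_mul_lt_sum (ν : ProbabilityMeasure 𝒳) {Z : 𝒳 → ℝ} (hZ : Measurable Z)
    (hZi : Integrable Z (ν : Measure 𝒳)) {c : ℝ} (hc : ∫ x, Z x ∂(ν : Measure 𝒳) < c) :
    Tendsto (fun w : ℕ => noChangeLaw ν {ω | c * w < ∑ i ∈ Finset.range w, Z (ω i)})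
      atTop (𝓝 0) := by
  set I := ∫ x, Z x ∂(ν : Measure 𝒳) with hI
  have hmp : ∀ n, MeasurePreserving (fun ω : ℕ → 𝒳 => ω n) (noChangeLaw ν) (ν : Measure 𝒳) :=
    fun n => measurePreserving_eval_infinitePi (fun _ => (ν : Measure 𝒳)) n
  have hident : ∀ n, IdentDistrib (fun ω : ℕ → 𝒳 => Z (ω n)) Z (noChangeLaw ν)
      (ν : Measure 𝒳) := fun n =>
    ⟨(hZ.comp (measurable_pi_apply n)).aemeasurable, hZ.aemeasurable, by
      rw [← (hmp n).map_eq, Measure.map_map hZ (measurable_pi_apply n)]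
      rfl⟩
  have hindep : iIndepFun (fun n (ω : ℕ → 𝒳) => Z (ω n)) (noChangeLaw ν) :=
    iIndepFun_infinitePi (X := fun _ => Z) fun _ => hZ
  have hlaw := strong_law_ae_real (μ := noChangeLaw ν) (fun n (ω : ℕ → 𝒳) => Z (ω n))
    ((hmp 0).integrable_comp_of_integrable hZi) (fun i j hij => hindep.indepFun hij)
    fun i => (hident i).trans (hident 0).symm
  have hmean : ∫ ω, Z (ω 0) ∂(noChangeLaw ν) = I := (hident 0).integral_eq
  rw [hmean] at hlaw
  have hm := tendstoInMeasure_of_tendsto_ae (μ := noChangeLaw ν) (fun n =>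
    ((Finset.measurable_sum _ fun i _ => hZ.comp (measurable_pi_apply i)).div_const
      (n : ℝ)).aestronglyMeasurable) hlaw
  have := tendstoInMeasure_iff_norm.1 hm (c - I) (sub_pos.2 hc)
  refine tendsto_of_tendsto_of_tendsto_of_le_of_le' tendsto_const_nhds this
    (Eventually.of_forall fun _ => zero_le) ?_
  filter_upwards [eventually_gt_atTop 0] with w hw
  refine measure_mono fun ω hω => ?_
  simp only [Set.mem_ofPred_eq] at hω ⊢
  have hw' : (0 : ℝ) < w := Nat.cast_pos.2 hw
  have h2 : c < (∑ i ∈ Finset.range w, Z (ω i)) / w := (lt_div_iff₀ hw').2 hω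
  rw [Real.norm_eq_abs]
  exact (sub_lt_sub_right h2 I).le.trans (le_abs_self _)

theorem measure_lt_prod_rnDeriv_le {ν₀ ν₁ : ProbabilityMeasure 𝒳}
    (hac : (ν₁ : Measure 𝒳) ≪ (ν₀ : Measure 𝒳)) {c d : ℝ} {w : ℕ} (hdc : d ≤ c) :
    noChangeLaw ν₁ {ω | ENNReal.ofReal (Real.exp c) <
        ∏ i ∈ Finset.range w, (ν₁ : Measure 𝒳).rnDeriv (ν₀ : Measure 𝒳) (ω i)} ≤
      noChangeLaw ν₁ {ω | d <
        ∑ i ∈ Finset.range w, llr (ν₁ : Measure 𝒳) (ν₀ : Measure 𝒳) (ω i)} := by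
  have hae : ∀ᵐ x ∂(ν₁ : Measure 𝒳), (ν₁ : Measure 𝒳).rnDeriv (ν₀ : Measure 𝒳) x =
      ENNReal.ofReal (Real.exp (llr (ν₁ : Measure 𝒳) (ν₀ : Measure 𝒳) x)) := by
    filter_upwards [hac (Measure.rnDeriv_lt_top (ν₁ : Measure 𝒳) (ν₀ : Measure 𝒳)),
      Measure.rnDeriv_pos hac] with x h1 h2
    rw [llr, Real.exp_log (ENNReal.toReal_pos h2.ne' h1.ne), ENNReal.ofReal_toReal h1.ne]
  have hae' : ∀ᵐ ω ∂(noChangeLaw ν₁), ∀ i, (ν₁ : Measure 𝒳).rnDeriv (ν₀ : Measure 𝒳) (ω i) =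
      ENNReal.ofReal (Real.exp (llr (ν₁ : Measure 𝒳) (ν₀ : Measure 𝒳) (ω i))) :=
    ae_all_iff.2 fun i => (measurePreserving_eval_infinitePi (fun _ => (ν₁ : Measure 𝒳))
      i).quasiMeasurePreserving.ae hae
  refine measure_mono_ae ?_
  filter_upwards [hae'] with ω hω h
  change d < ∑ i ∈ Finset.range w, llr (ν₁ : Measure 𝒳) (ν₀ : Measure 𝒳) (ω i)
  change ENNReal.ofReal (Real.exp c) <
    ∏ i ∈ Finset.range w, (ν₁ : Measure 𝒳).rnDeriv (ν₀ : Measure 𝒳) (ω i) at h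
  rw [Finset.prod_congr rfl fun i _ => hω i,
    ← ENNReal.ofReal_prod_of_nonneg fun _ _ => (Real.exp_pos _).le, ← Real.exp_sum] at h
  exact hdc.trans_lt (Real.exp_lt_exp.1 (ENNReal.ofReal_lt_ofReal_iff'.1 h).1)

theorem tendsto_abs_log_nhdsGT_zero : Tendsto (fun α : ℝ => |Real.log α|) (𝓝[>] 0) atTop :=
  tendsto_abs_atBot_atTop.comp Real.tendsto_log_nhdsGT_zero

theorem tendsto_mul_exp_neg_mul {k : ℝ} (hk : 0 < k) :
    Tendsto (fun b : ℝ => b * Real.exp (-(k * b))) atTop (𝓝 0) := by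
  have h := ((Real.tendsto_pow_mul_exp_neg_atTop_nhds_zero 1).comp
    (tendsto_id.const_mul_atTop hk)).const_mul k⁻¹
  rw [mul_zero] at h
  refine h.congr fun b => ?_
  simp only [Function.comp_apply, id, pow_one]
  field_simp

/-- Lorden's asymptotic lower bound for the worst-case delay, uniformly over all rules that satisfy
the false alarm constraint. -/
theorem eventually_le_WDD {ν₀ ν₁ : ProbabilityMeasure 𝒳} (hfin : KL ν₁ ν₀ ≠ ∞)
    (hpos : 0 < (KL ν₁ ν₀).toReal) {δ : ℝ} (hδ0 : 0 < δ) (hδ1 : δ < 1) :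
    ∀ᶠ α in 𝓝[>] (0 : ℝ), ∀ τ : (ℕ → 𝒳) → ℕ∞, IsStoppingRule τ →
      FAR ν₀ τ ≤ ENNReal.ofReal α →
      ENNReal.ofReal ((1 - δ) * |Real.log α| / (KL ν₁ ν₀).toReal) ≤ WDD ν₀ ν₁ τ := by
  set I := (KL ν₁ ν₀).toReal with hI
  obtain ⟨hac, hint⟩ := klDiv_ne_top_iff.1 hfin
  -- With b = |log α| and c = exp((1 − δ/4)b): since (1 + δ/4)(1 − δ/2) ≤ 1 − δ/4, the law of large
  -- numbers makes a ratio above c unlikely, and c · 2wα = 2w exp(−δb/4) tends to 0.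
  set w : ℝ → ℕ := fun b => ⌊(1 - δ / 2) * b / I⌋₊ with hw
  have hwtop : Tendsto w atTop atTop := by
    refine tendsto_nat_floor_atTop.comp ((tendsto_id.const_mul_atTop
      (by linarith : 0 < 1 - δ / 2)).atTop_div_const hpos)
  have hp := (tendsto_measure_mul_lt_sum ν₁ (measurable_llr (ν₁ : Measure 𝒳) (ν₀ : Measure 𝒳))
    hint (c := I * (1 + δ / 4)) (by rw [← KL_toReal hfin]; nlinarith)).comp hwtop
  have he := (tendsto_mul_exp_neg_mul (by linarith : 0 < δ / 4)).const_mul (2 / I)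
  rw [mul_zero] at he
  have hE : ∀ᶠ b in atTop, 0 < w b ∧ noChangeLaw ν₁ {ω | I * (1 + δ / 4) * (w b : ℕ) <
      ∑ i ∈ Finset.range (w b), llr (ν₁ : Measure 𝒳) (ν₀ : Measure 𝒳) (ω i)} ≤
        ENNReal.ofReal (δ / 8) ∧
      2 / I * (b * Real.exp (-(δ / 4 * b))) ≤ δ / 8 ∧ 4 * I / δ ≤ b ∧ 0 < b := by
    filter_upwards [hwtop.eventually_gt_atTop 0,
      hp.eventually_le_const (by simpa using hδ0 : 0 < ENNReal.ofReal (δ / 8)),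
      he.eventually_le_const (by linarith : 0 < δ / 8), eventually_ge_atTop (4 * I / δ),
      eventually_gt_atTop 0] with b h1 h2 h3 h4 h5 using ⟨h1, h2, h3, h4, h5⟩
  filter_upwards [tendsto_abs_log_nhdsGT_zero.eventually hE, self_mem_nhdsWithin,
    Ioo_mem_nhdsGT (zero_lt_one' ℝ)] with α hα h0 h1 τ hτ hfar
  rw [Set.mem_Ioi] at h0
  set b := |Real.log α| with hb
  obtain ⟨hw0, hpw, hew, hbI, hb0⟩ := hα
  have hαb : α = Real.exp (-b) := by
    rw [hb, abs_of_neg (Real.log_neg h0 h1.2), neg_neg, Real.exp_log h0]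
  have hwle : (w b : ℝ) ≤ (1 - δ / 2) * b / I :=
    Nat.floor_le (div_nonneg (mul_nonneg (by linarith) hb0.le) hpos.le)
  have hwge : (1 - δ / 2) * b / I < w b + 1 := Nat.lt_floor_add_one _
  have key := natCast_le_add_WDD (ν₁ := ν₁) hac hτ (by simpa using h0) ENNReal.ofReal_ne_top hfar
    hw0 (ENNReal.ofReal (Real.exp ((1 - δ / 4) * b)))
  have hdc : I * (1 + δ / 4) * (w b : ℕ) ≤ (1 - δ / 4) * b := by
    rw [le_div_iff₀ hpos] at hwle
    have : (1 + δ / 4) * (w b * I) ≤ (1 + δ / 4) * ((1 - δ / 2) * b) := by gcongr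
    nlinarith [mul_pos (mul_pos hδ0 hδ0) hb0]
  have hq : ENNReal.ofReal (Real.exp ((1 - δ / 4) * b)) * (2 * (w b : ℕ) * ENNReal.ofReal α) +
      noChangeLaw ν₁ {ω | ENNReal.ofReal (Real.exp ((1 - δ / 4) * b)) <
        ∏ i ∈ Finset.range (w b), (ν₁ : Measure 𝒳).rnDeriv (ν₀ : Measure 𝒳) (ω i)} ≤
      ENNReal.ofReal (δ / 4) := by
    have hsplit : ENNReal.ofReal (δ / 4) = ENNReal.ofReal (δ / 8) + ENNReal.ofReal (δ / 8) := by
      rw [← ENNReal.ofReal_add (by linarith) (by linarith)]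
      congr 1
      ring
    rw [hsplit]
    refine add_le_add ?_ ((measure_lt_prod_rnDeriv_le hac hdc).trans hpw)
    have : (2 : ℝ≥0∞) * (w b : ℕ) = ENNReal.ofReal (2 * (w b : ℕ)) := by
      rw [ENNReal.ofReal_mul zero_le_two, ENNReal.ofReal_natCast, ENNReal.ofReal_ofNat]
    rw [this, ← ENNReal.ofReal_mul (by positivity), ← ENNReal.ofReal_mul (by positivity)]
    refine ENNReal.ofReal_le_ofReal (le_trans ?_ hew)
    have hex : Real.exp ((1 - δ / 4) * b) * α = Real.exp (-(δ / 4 * b)) := by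
      rw [hαb, ← Real.exp_add]
      congr 1
      ring
    calc Real.exp ((1 - δ / 4) * b) * (2 * (w b : ℕ) * α)
        = 2 * (w b : ℕ) * (Real.exp ((1 - δ / 4) * b) * α) := by ring
      _ = 2 * (w b : ℕ) * Real.exp (-(δ / 4 * b)) := by rw [hex]
      _ ≤ 2 * (b / I) * Real.exp (-(δ / 4 * b)) := by
          gcongr
          refine hwle.trans (div_le_div_of_nonneg_right ?_ hpos.le)
          nlinarith
      _ = _ := by ring
  have hfinal : (w b : ℝ≥0∞) ≤ (w b : ℝ≥0∞) * ENNReal.ofReal (δ / 4) + WDD ν₀ ν₁ τ :=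
    key.trans (add_le_add_left (mul_le_mul' le_rfl hq) _)
  have hwsplit : (w b : ℝ≥0∞) = (w b : ℝ≥0∞) * ENNReal.ofReal (δ / 4) +
      ENNReal.ofReal ((w b : ℝ) * (1 - δ / 4)) := by
    rw [← ENNReal.ofReal_natCast, ← ENNReal.ofReal_mul (by positivity),
      ← ENNReal.ofReal_add (by positivity) (mul_nonneg (by positivity) (by linarith))]
    congr 1
    ring
  rw [hwsplit] at hfinal
  conv_rhs at hfinal => rw [← hwsplit]
  have hWDD := (ENNReal.add_le_add_iff_left (ENNReal.mul_ne_top (ENNReal.natCast_ne_top _)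
    ENNReal.ofReal_ne_top)).1 hfinal
  refine le_trans (ENNReal.ofReal_le_ofReal ?_) hWDD
  -- This size of b absorbs the unit lost in the floor.
  have hbI' : 4 / δ ≤ b / I := by
    rw [le_div_iff₀ hpos]
    exact (le_of_eq (by ring)).trans hbI
  rw [div_le_iff₀ hδ0] at hbI'
  rw [mul_div_assoc] at hwge ⊢
  have h1 : ((1 - δ / 2) * (b / I) - 1) * (1 - δ / 4) ≤ (w b : ℝ) * (1 - δ / 4) :=
    mul_le_mul_of_nonneg_right (by linarith) (by linarith)
  nlinarith [mul_nonneg (mul_nonneg hδ0.le hδ0.le) (div_nonneg hb0.le hpos.le)]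

/-! ### Asymptotic upper bound and extraction of o(1) -/

theorem tendsto_integral_min_natCast {ν : Measure 𝒳} {Z : 𝒳 → ℝ} (hZi : Integrable Z ν) :
    Tendsto (fun n : ℕ => ∫ x, min (Z x) n ∂ν) atTop (𝓝 (∫ x, Z x ∂ν)) := by
  refine tendsto_integral_of_dominated_convergence (fun x => |Z x|)
    (fun n => hZi.aestronglyMeasurable.inf aestronglyMeasurable_const) hZi.abs ?_ ?_
  · refine fun n => ae_of_all _ fun x => ?_
    rw [Real.norm_eq_abs]
    have hn : (0 : ℝ) ≤ n := Nat.cast_nonneg n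
    rcases le_total (Z x) n with h | h
    · rw [min_eq_left h]
    · rw [min_eq_right h, abs_of_nonneg hn]
      exact h.trans (le_abs_self _)
  · refine ae_of_all _ fun x => tendsto_const_nhds.congr' ?_
    filter_upwards [eventually_ge_atTop ⌈Z x⌉₊] with n hn
    exact (min_eq_left (Nat.ceil_le.1 hn)).symm

/-- The asymptotic upper bound for the mean time to alarm under a law that gives the increments of
the CUSUM statistic a positive mean. -/
theorem eventually_meanTimeFA_cusum_le {L : 𝒳 → EReal} (hL : Measurable L)
    (ν : ProbabilityMeasure 𝒳) (hZi : Integrable (fun x => (L x).toReal) (ν : Measure 𝒳))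
    (hLZ : ∀ᵐ x ∂(ν : Measure 𝒳), L x = ((L x).toReal : EReal))
    (hpos : 0 < ∫ x, (L x).toReal ∂(ν : Measure 𝒳)) {ε : ℝ} (hε : 0 < ε) :
    ∀ᶠ α in 𝓝[>] (0 : ℝ), meanTimeFA ν (cusum L |Real.log α|) ≤
      ENNReal.ofReal ((1 + ε) * |Real.log α| / ∫ x, (L x).toReal ∂(ν : Measure 𝒳)) := by
  set J := ∫ x, (L x).toReal ∂(ν : Measure 𝒳) with hJ
  have hlt : J / (1 + ε / 2) < J := div_lt_self hpos (by linarith)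
  -- A fixed truncation level n costs a factor 1 + ε/2 in the drift; the overshoot n is absorbed in
  -- another (ε/2)|log α| for small α.
  obtain ⟨n, hn⟩ := ((tendsto_integral_min_natCast hZi).eventually_const_lt hlt).exists
  set I := ∫ x, min (L x).toReal n ∂(ν : Measure 𝒳) with hI
  have hI0 : 0 < I := lt_trans (div_pos hpos (by linarith)) hn
  filter_upwards [tendsto_abs_log_nhdsGT_zero.eventually_ge_atTop
    (n * (1 + ε / 2) / (ε / 2))] with α hα
  refine (meanTimeFA_cusum_le hL ν (hL.ereal_toReal.min measurable_const)
    (hZi.inf (integrable_const (n : ℝ))) ?_ (abs_nonneg _) (Nat.cast_nonneg n)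
    (fun x => min_le_right _ _) hI0).trans (ENNReal.ofReal_le_ofReal ?_)
  · filter_upwards [hLZ] with x hx
    conv_rhs => rw [hx]
    exact EReal.coe_le_coe_iff.2 (min_le_left _ _)
  · rw [div_le_iff₀ (by linarith)] at hα
    rw [div_lt_iff₀ (by linarith)] at hn
    rw [div_le_div_iff₀ hI0 hpos]
    have hb := abs_nonneg (Real.log α)
    have hn0 : (0 : ℝ) ≤ n := Nat.cast_nonneg n
    calc (|Real.log α| + n) * J ≤ (|Real.log α| + n) * (I * (1 + ε / 2)) := by gcongr
      _ = (|Real.log α| * (1 + ε / 2) + n * (1 + ε / 2)) * I := by ring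
      _ ≤ (|Real.log α| * (1 + ε / 2) + |Real.log α| * (ε / 2)) * I := by gcongr
      _ = (1 + ε) * |Real.log α| * I := by ring

/-- Take o(α) as the infimum of admissible ε, plus α so that some admissible ε lies below it.
Quantifying over thresholds and rules inside `p` keeps o independent of them. -/
theorem exists_tendsto_zero_of_forall_eventually {p : ℝ → ℝ → Prop}
    (hmono : ∀ α ε ε', ε ≤ ε' → p α ε → p α ε')
    (h : ∀ ε > 0, ∀ᶠ α in 𝓝[>] (0 : ℝ), p α ε) :
    ∃ o : ℝ → ℝ, Tendsto o (𝓝[>] 0) (𝓝 0) ∧ ∀ᶠ α in 𝓝[>] (0 : ℝ), p α (o α) := by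
  have hbdd : ∀ α, BddBelow {ε | 0 < ε ∧ p α ε} := fun α => ⟨0, fun ε hε => hε.1.le⟩
  have hnn : ∀ α, 0 ≤ sInf {ε | 0 < ε ∧ p α ε} := fun α => Real.sInf_nonneg fun ε hε => hε.1.le
  refine ⟨fun α => sInf {ε | 0 < ε ∧ p α ε} + α, ?_, ?_⟩
  · have h1 : Tendsto (fun α => sInf {ε | 0 < ε ∧ p α ε}) (𝓝[>] (0 : ℝ)) (𝓝 0) := by
      refine tendsto_order.2 ⟨fun a ha => Eventually.of_forall fun α => ha.trans_le (hnn α),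
        fun a ha => ?_⟩
      filter_upwards [h (a / 2) (half_pos ha)] with α hα
      exact (csInf_le (hbdd α) ⟨half_pos ha, hα⟩).trans_lt (half_lt_self ha)
    simpa using h1.add (tendsto_nhdsWithin_of_tendsto_nhds tendsto_id)
  · filter_upwards [h 1 one_pos, self_mem_nhdsWithin] with α h1 hα
    rw [Set.mem_Ioi] at hα
    obtain ⟨ε, hε, hlt⟩ := exists_lt_of_csInf_lt (s := {ε | 0 < ε ∧ p α ε}) ⟨1, one_pos, h1⟩
      (lt_add_of_pos_right _ hα)
    exact hmono α ε _ hlt.le hε.2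

end QuickestChange

end

/-! ### Assembly of the four claims -/

open QuickestChange

theorem mainTheorem4 {𝒳 : Type*} [MeasurableSpace 𝒳]
    (P₀ P₁ : Set (ProbabilityMeasure 𝒳)) (ν₀bar ν₁bar : ProbabilityMeasure 𝒳)
    (Lstar : 𝒳 → EReal)
    (hJSB : QuickestChange.JointlyStochBounded P₀ P₁ ν₀bar ν₁bar Lstar)
    (hne : ν₁bar ≠ ν₀bar)
    (ν₀ ν₁ : ProbabilityMeasure 𝒳) (hν₀ : ν₀ ∈ P₀) (hν₁ : ν₁ ∈ P₁)
    (hfin₀ : QuickestChange.KL ν₁ ν₀bar ≠ ∞) (hfin₁ : QuickestChange.KL ν₁ ν₁bar ≠ ∞) :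
    -- the denominator `D(ν₁ ‖ ν₀bar) - D(ν₁ ‖ ν₁bar)` is positive
    QuickestChange.KL ν₁ ν₁bar < QuickestChange.KL ν₁ ν₀bar ∧
    -- the robust CUSUM satisfies the false alarm constraint
    (∀ α : ℝ, 0 < α → α < 1 → ∀ η : ℝ,
      QuickestChange.IsCusumThreshold ν₀bar Lstar α η →
      QuickestChange.FAR ν₀ (QuickestChange.cusum Lstar η) ≤ ENNReal.ofReal α) ∧
    -- the bound on its worst-case delay
    (∃ o : ℝ → ℝ, Tendsto o (𝓝[>] 0) (𝓝 0) ∧ ∀ᶠ α in 𝓝[>] (0 : ℝ), ∀ η : ℝ,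
      QuickestChange.IsCusumThreshold ν₀bar Lstar α η →
      QuickestChange.WDD ν₀ ν₁ (QuickestChange.cusum Lstar η) ≤
        ENNReal.ofReal (|Real.log α| * (1 + o α)) /
          (QuickestChange.KL ν₁ ν₀bar - QuickestChange.KL ν₁ ν₁bar)) ∧
    -- comparison with every rule satisfying the constraint, in particular the optimal CUSUM
    (∃ o : ℝ → ℝ, Tendsto o (𝓝[>] 0) (𝓝 0) ∧ ∀ᶠ α in 𝓝[>] (0 : ℝ), ∀ η : ℝ,
      QuickestChange.IsCusumThreshold ν₀bar Lstar α η →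
      (∀ τ : (ℕ → 𝒳) → ℕ∞, QuickestChange.IsStoppingRule τ →
        QuickestChange.FAR ν₀ τ ≤ ENNReal.ofReal α →
        QuickestChange.WDD ν₀ ν₁ (QuickestChange.cusum Lstar η) ≤
          ENNReal.ofReal (1 + o α) *
            (QuickestChange.KL ν₁ ν₀ /
              (QuickestChange.KL ν₁ ν₀bar - QuickestChange.KL ν₁ ν₁bar)) *
            QuickestChange.WDD ν₀ ν₁ τ) ∧
      (∀ (L : 𝒳 → EReal) (η' : ℝ), QuickestChange.IsLLR L ν₁ ν₀ →
        QuickestChange.IsCusumThreshold ν₀ L α η' →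
        QuickestChange.WDD ν₀ ν₁ (QuickestChange.cusum Lstar η) ≤
          ENNReal.ofReal (1 + o α) *
            (QuickestChange.KL ν₁ ν₀ /
              (QuickestChange.KL ν₁ ν₀bar - QuickestChange.KL ν₁ ν₁bar)) *
            QuickestChange.WDD ν₀ ν₁ (QuickestChange.cusum L η'))) := by
  have hLLR := hJSB.isLLR
  have hL := hLLR.measurable
  have hac₀ := (klDiv_ne_top_iff.1 hfin₀).1
  have hac₁ := (klDiv_ne_top_iff.1 hfin₁).1
  have hZi := hLLR.integrable_toReal hfin₀ hfin₁
  have hJ := hJSB.integral_toReal_pos hne hν₁ hfin₀ hfin₁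
  have hLZ : ∀ᵐ x ∂(ν₁ : Measure 𝒳), Lstar x = ((Lstar x).toReal : EReal) := by
    filter_upwards [hLLR.ae_eq_llr_sub hac₀ hac₁] with x hx using hx.1
  have hJeq := hLLR.integral_toReal hfin₀ hfin₁
  set J := ∫ x, (Lstar x).toReal ∂(ν₁ : Measure 𝒳) with hJdef
  have hsub : KL ν₁ ν₀bar - KL ν₁ ν₁bar = ENNReal.ofReal J := by
    rw [hJeq, ENNReal.ofReal_sub _ ENNReal.toReal_nonneg, ENNReal.ofReal_toReal hfin₀,
      ENNReal.ofReal_toReal hfin₁]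
  have hupper : ∀ ε > 0, ∀ᶠ α in 𝓝[>] (0 : ℝ), ∀ η : ℝ, IsCusumThreshold ν₀bar Lstar α η →
      WDD ν₀ ν₁ (cusum Lstar η) ≤ ENNReal.ofReal ((1 + ε) * |Real.log α| / J) := by
    intro ε hε
    filter_upwards [eventually_meanTimeFA_cusum_le hL ν₁ hZi hLZ hJ hε,
      Ioo_mem_nhdsGT (zero_lt_one' ℝ)] with α hα h01 η hη
    refine (WDD_cusum_le_meanTimeFA hL ν₀ ν₁ η).trans (le_trans (lintegral_mono fun ω => ?_) hα)
    exact ENat.toENNReal_le.2 (cusum_mono Lstar (hη.le_abs_log hLLR h01.1 h01.2) ω)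
  refine ⟨?_, ?_, ?_, ?_⟩
  · rw [← tsub_pos_iff_lt, hsub]
    exact ENNReal.ofReal_pos.2 hJ
  · intro α h0 h1 η hη
    exact FAR_le_of_inv_le ((hη.inv_le_meanTimeFA hLLR h0 h1).trans
      (meanTimeFA_cusum_le_of_stochLarger hL (hJSB.larger₀ ν₀ hν₀) η))
  · refine exists_tendsto_zero_of_forall_eventually (p := fun α ε => ∀ η : ℝ,
      IsCusumThreshold ν₀bar Lstar α η → WDD ν₀ ν₁ (cusum Lstar η) ≤
        ENNReal.ofReal (|Real.log α| * (1 + ε)) / (KL ν₁ ν₀bar - KL ν₁ ν₁bar)) ?_ ?_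
    · intro α ε ε' hεε' h η hη
      refine (h η hη).trans (ENNReal.div_le_div_right (ENNReal.ofReal_le_ofReal ?_) _)
      gcongr
    · intro ε hε
      filter_upwards [hupper ε hε] with α hα η hη
      rw [hsub, ← ENNReal.ofReal_div_of_pos hJ, mul_comm |Real.log α|]
      exact hα η hη
  · have hrules : ∃ o : ℝ → ℝ, Tendsto o (𝓝[>] 0) (𝓝 0) ∧ ∀ᶠ α in 𝓝[>] (0 : ℝ), ∀ η : ℝ,
        IsCusumThreshold ν₀bar Lstar α η → ∀ τ : (ℕ → 𝒳) → ℕ∞, IsStoppingRule τ →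
          FAR ν₀ τ ≤ ENNReal.ofReal α → WDD ν₀ ν₁ (cusum Lstar η) ≤ ENNReal.ofReal (1 + o α) *
            (KL ν₁ ν₀ / (KL ν₁ ν₀bar - KL ν₁ ν₁bar)) * WDD ν₀ ν₁ τ := by
      refine exists_tendsto_zero_of_forall_eventually (p := fun α ε => ∀ η : ℝ,
        IsCusumThreshold ν₀bar Lstar α η → ∀ τ : (ℕ → 𝒳) → ℕ∞, IsStoppingRule τ →
          FAR ν₀ τ ≤ ENNReal.ofReal α → WDD ν₀ ν₁ (cusum Lstar η) ≤ ENNReal.ofReal (1 + ε) *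
            (KL ν₁ ν₀ / (KL ν₁ ν₀bar - KL ν₁ ν₁bar)) * WDD ν₀ ν₁ τ) ?_ ?_
      · intro α ε ε' hεε' h η hη τ hτ hfar
        refine (h η hη τ hτ hfar).trans ?_
        gcongr
      intro ε hε
      by_cases hfin : KL ν₁ ν₀ = ∞
      · filter_upwards with α η _ τ hτ hfar
        -- The right side is infinite, because the delay of the competing rule is nonzero.
        rw [hfin, hsub, ENNReal.top_div_of_ne_top ENNReal.ofReal_ne_top, ENNReal.mul_top,
          ENNReal.top_mul (WDD_ne_zero hτ ENNReal.ofReal_ne_top hfar)]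
        · exact le_top
        · exact (ENNReal.ofReal_pos.2 (by linarith)).ne'
      have hKpos : 0 < (KL ν₁ ν₀).toReal := by
        refine ENNReal.toReal_pos (fun h0 => hJSB.ne hne hν₀ hν₁ (Subtype.ext ?_)) hfin
        exact (klDiv_eq_zero_iff (μ := (ν₁ : Measure 𝒳)) (ν := (ν₀ : Measure 𝒳))).1 h0
      set I := (KL ν₁ ν₀).toReal with hI
      have hKL : KL ν₁ ν₀ = ENNReal.ofReal I := (ENNReal.ofReal_toReal hfin).symm
      -- Chosen so that (1 + ε)(1 − δ) = 1 + ε/2, which matches the upper and lower bounds.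
      set δ := ε / (2 * (1 + ε)) with hδ
      have hδ0 : 0 < δ := by positivity
      have hδ1 : δ < 1 := by
        rw [hδ, div_lt_one (by positivity)]
        linarith
      filter_upwards [hupper (ε / 2) (half_pos hε), eventually_le_WDD hfin hKpos hδ0 hδ1]
        with α hα hlow η hη τ hτ hfar
      refine (hα η hη).trans ?_
      have heq : (1 + ε / 2) * |Real.log α| / J =
          (1 + ε) * (I / J) * ((1 - δ) * |Real.log α| / I) := by
        have h1 : (1 + ε) * (1 - δ) = 1 + ε / 2 := by
          rw [hδ]
          field_simp
          ring
        rw [← h1]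
        field_simp
      rw [heq, ENNReal.ofReal_mul (by positivity), ENNReal.ofReal_mul (by positivity),
        ENNReal.ofReal_div_of_pos hJ, ← hKL, ← hsub]
      exact mul_le_mul' le_rfl (hlow τ hτ hfar)
    obtain ⟨o, ho, hev⟩ := hrules
    refine ⟨o, ho, ?_⟩
    filter_upwards [hev, Ioo_mem_nhdsGT (zero_lt_one' ℝ)] with α hα h01 η hη
    exact ⟨hα η hη, fun L η' hLLR' hη' => hα η hη _ (isStoppingRule_cusum hLLR'.measurable η')
      (FAR_le_of_inv_le (hη'.inv_le_meanTimeFA hLLR' h01.1 h01.2))⟩
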